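/- Let $K$ be a field, let $n = 2r+1$ with $r \ge 2$, and let $C_n$ be the cycle on the vertices $1, \dots, n$. Let $B = K[x_1, \dots, x_n]$ and let $I = P_{n-2}(C_n) \subseteq B$ be the ideal generated by the monomials $m_1, \dots, m_n$ of the paths on $n-2$ vertices in $C_n$ (a path with vertices $v_1, \dots, v_{n-2}$ has the monomial $x_{v_1} \cdots x_{v_{n-2}}$, so $m_i = x_i x_{i+1} \cdots x_{i+n-3}$ with indices modulo $n$). Let $\mathcal R(I) = B[It]$ be the Rees algebra, regarded as a bigraded module over $S = K[x_1, \dots, x_n, y_1, \dots, y_n]$, where $\deg x_i = (1,0)$ and $\deg y_j = (0,1)$, through $x_i \mapsto x_i$, $y_j \mapsto m_j t$. Its piece of bidegree $(a,b)$ is $(I^b)_{a+(n-2)b}\, t^b$. For a bigraded $S$-module $M$ put $$t_{i,y}(M) = \sup\{ j : \operatorname{Tor}_i^S(M,K)_{(*,j)} \ne 0 \}, \qquad \operatorname{reg}_y(M) = \sup\{ t_{i,y}(M) - i : i \ge 0 \},$$ where $\sup \emptyset = -\infty$. Then: 1. $\operatorname{reg}_y \mathcal R(I) \ge r-1$. 2.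 $I$ is of linear type, that is, the canonical surjection $\operatorname{Sym}(I) \to \mathcal R(I)$ is an isomorphism. 3. $I$ is not generated by a $d$-sequence: there is no finite sequence $a_1, \dots, a_m$ in $B$ with $I = \langle a_1, \dots, a_m \rangle$ and $(\langle a_1, \dots, a_{i-1} \rangle : a_i) \cap I = \langle a_1, \dots, a_{i-1} \rangle$ for all $i = 1, \dots, m$. So these ideals, for $r = 2, 3, \dots$, are of linear type, are not generated by $d$-sequences, and have $y$-regularities that are unbounded as $n$ grows. -/

import Mathlib

/-- The bidegree on exponents in `K[X, Y]`: every variable of `X` has bidegree `(1, 0)`,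
every variable of `Y` has bidegree `(0, 1)`. -/
noncomputable def bidegree {σ : Type*} {τ : Type*} : ((σ ⊕ τ) →₀ ℕ) →+ ℕ × ℕ :=
  Finsupp.weight (Sum.elim (fun _ : σ => ((1, 0) : ℕ × ℕ)) (fun _ : τ => ((0, 1) : ℕ × ℕ)))

universe u

section Tor

variable (K : Type u) [Field K] (σ : Type) (τ : Type u)

/-- A bigraded free resolution `⋯ → F₂ → F₁ → F₀ → M → 0` over the bigraded polynomial ring
`S = K[X, Y]`, where `M` is an `S`-module with bigraded pieces `𝓜`. The module `F i` is free on a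
basis `ι i`, the basis element `b` having bidegree `deg i b`, and all maps have bidegree `(0, 0)`. -/
structure BigradedFreeResolution {M : Type u} [AddCommGroup M]
    [Module (MvPolynomial (σ ⊕ τ) K) M] (𝓜 : ℕ × ℕ → AddSubgroup M) where
  ι : ℕ → Type u
  deg : ∀ i, ι i → ℕ × ℕ
  d : ∀ i, (ι (i + 1) →₀ MvPolynomial (σ ⊕ τ) K) →ₗ[MvPolynomial (σ ⊕ τ) K]
    (ι i →₀ MvPolynomial (σ ⊕ τ) K)
  aug : (ι 0 →₀ MvPolynomial (σ ⊕ τ) K) →ₗ[MvPolynomial (σ ⊕ τ) K] M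
  d_homogeneous : ∀ i (b : ι (i + 1)) (c : ι i), ∀ s ∈ (d i (Finsupp.single b 1) c).support,
    bidegree s + deg i c = deg (i + 1) b
  aug_homogeneous : ∀ b : ι 0, aug (Finsupp.single b 1) ∈ 𝓜 (deg 0 b)
  aug_surjective : Function.Surjective aug
  exact_zero : Function.Exact (d 0) aug
  exact_succ : ∀ i, Function.Exact (d (i + 1)) (d i)

namespace BigradedFreeResolution

variable {K σ τ} {M : Type u} [AddCommGroup M] [Module (MvPolynomial (σ ⊕ τ) K) M]
  {𝓜 : ℕ × ℕ → AddSubgroup M}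

/-- The differential of `F ⊗_S K`, where `K = S / (X, Y)` and `F i ⊗_S K` is the vector space with
basis `ι i`: the entries of the matrix of `d i` are replaced by their constant terms. -/
noncomputable def dK (F : BigradedFreeResolution K σ τ 𝓜) (i : ℕ) :
    (F.ι (i + 1) →₀ K) →ₗ[K] (F.ι i →₀ K) :=
  Finsupp.linearCombination K fun b =>
    Finsupp.mapRange MvPolynomial.constantCoeff (map_zero _) (F.d i (Finsupp.single b 1))

/-- The cycles of `F ⊗_S K` in homological degree `i`. -/
noncomputable def cycles (F : BigradedFreeResolution K σ τ 𝓜) :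
    ∀ i : ℕ, Submodule K (F.ι i →₀ K)
  | 0 => ⊤
  | i + 1 => LinearMap.ker (F.dK i)

/-- The cycles of `F ⊗_S K` in homological degree `i` and bidegree `e`. -/
noncomputable def bigradedCycles (F : BigradedFreeResolution K σ τ 𝓜) (i : ℕ) (e : ℕ × ℕ) :
    Submodule K (F.ι i →₀ K) :=
  F.cycles i ⊓ Finsupp.supported K K {b | F.deg i b = e}

end BigradedFreeResolution

variable {M : Type u} [AddCommGroup M] [Module (MvPolynomial (σ ⊕ τ) K) M]
  (𝓜 : ℕ × ℕ → AddSubgroup M)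

/-- `Tor_i^S(M, K)_e ≠ 0`, where `Tor_i^S(M, K) = H_i(F ⊗_S K)` for a bigraded free resolution `F`
of `M`: some cycle of bidegree `e` is not a boundary. By the comparison theorem for resolutions, this
does not depend on the choice of `F`. -/
def TorNeZero (i : ℕ) (e : ℕ × ℕ) : Prop :=
  ∃ F : BigradedFreeResolution K σ τ 𝓜, ¬ F.bigradedCycles i e ≤ LinearMap.range (F.dK i)

/-- `t_{i,y}(M) = sup {j : Tor_i^S(M, K)_{(*, j)} ≠ 0}`, which is `-∞` if there is no such `j`. -/
noncomputable def torTopYDegree (i : ℕ) : EReal :=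
  sSup {t : EReal | ∃ a j : ℕ, TorNeZero K σ τ 𝓜 i (a, j) ∧ t = (j : EReal)}

/-- The `y`-regularity `reg_y(M) = sup {t_{i,y}(M) - i : i ≥ 0}`. -/
noncomputable def yRegularity : EReal :=
  ⨆ i : ℕ, (torTopYDegree K σ τ 𝓜 i - (i : EReal))

end Tor

section Rees

variable {K : Type u} [Field K] {σ : Type}

/-- The Rees algebra `𝓡(I) = B[It]`, `B = K[X]`, of the ideal `I` generated by the set `gens`. -/
def ReesOfGenerators (gens : Set (MvPolynomial σ K)) : Type u :=
  reesAlgebra (Ideal.span gens)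

noncomputable instance (gens : Set (MvPolynomial σ K)) : CommRing (ReesOfGenerators gens) :=
  inferInstanceAs (CommRing (reesAlgebra (Ideal.span gens)))

noncomputable instance (gens : Set (MvPolynomial σ K)) : Algebra K (ReesOfGenerators gens) :=
  inferInstanceAs (Algebra K (reesAlgebra (Ideal.span gens)))

/-- The presentation of `𝓡(I)` as a quotient of `S = K[X, Y]`, with one variable `y_m` for each
generator `m`: it sends `x_v` to `x_v` and `y_m` to `m t`. -/
noncomputable def reesPresentation (gens : Set (MvPolynomial σ K)) :
    MvPolynomial (σ ⊕ gens) K →ₐ[K] ReesOfGenerators gens :=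
  MvPolynomial.aeval (Sum.elim
    (fun v => (algebraMap (MvPolynomial σ K) (reesAlgebra (Ideal.span gens)) (MvPolynomial.X v) :
      reesAlgebra (Ideal.span gens)))
    (fun m => (⟨Polynomial.monomial 1 (m : MvPolynomial σ K),
      reesAlgebra.monomial_mem.2 (by simpa using Ideal.subset_span m.2)⟩ : reesAlgebra (Ideal.span gens))))

noncomputable instance (gens : Set (MvPolynomial σ K)) :
    Module (MvPolynomial (σ ⊕ gens) K) (ReesOfGenerators gens) :=
  Module.compHom (ReesOfGenerators gens) (reesPresentation gens).toRingHom

/-- The bigraded pieces of `𝓡(I)` when the generators of `I` are homogeneous of degree `δ`: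
the piece of bidegree `(a, b)` is `(I ^ b)_{a + δ b} t ^ b`, so that `x_v` has bidegree `(1, 0)`
and `m t` has bidegree `(0, 1)`. -/
noncomputable def reesPiece (gens : Set (MvPolynomial σ K)) (δ : ℕ) (e : ℕ × ℕ) :
    AddSubgroup (ReesOfGenerators gens) :=
  ((MvPolynomial.homogeneousSubmodule σ K (e.1 + δ * e.2)).toAddSubgroup.map
    (Polynomial.monomial (R := MvPolynomial σ K) e.2).toAddMonoidHom).comap
      (reesAlgebra (Ideal.span gens)).val.toLinearMap.toAddMonoidHom

/-- `reg_y 𝓡(I)` for the ideal `I` generated by the set `gens` of forms of degree `δ`. -/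
noncomputable def reesYRegularity (gens : Set (MvPolynomial σ K)) (δ : ℕ) : EReal :=
  yRegularity K σ gens (reesPiece gens δ)

end Rees

section Ideals

/-- The monomials of the paths with `l` vertices in the graph `G`. -/
def pathMonomials (K : Type u) [Field K] {V : Type} (G : SimpleGraph V) (l : ℕ) :
    Set (MvPolynomial V K) :=
  {f | ∃ (v w : V) (p : G.Walk v w), p.IsPath ∧ p.support.length = l ∧
    f = (p.support.map MvPolynomial.X).prod}

/-- The path ideal `P_l(G)`. -/
noncomputable def pathIdeal (K : Type u) [Field K] {V : Type} (G : SimpleGraph V) (l : ℕ) :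
    Ideal (MvPolynomial V K) :=
  Ideal.span (pathMonomials K G l)

variable {A : Type*} [CommRing A]

/-- The map `I → A[It]`, `a ↦ a t`. -/
noncomputable def toReesDegreeOne (I : Ideal A) : I →ₗ[A] reesAlgebra I :=
  LinearMap.codRestrict (Subalgebra.toSubmodule (reesAlgebra I))
    ((Polynomial.monomial 1).comp I.subtype) (fun a => reesAlgebra.monomial_mem.2 (by simp))

/-- `I` is of linear type: the canonical map `Sym(I) → A[It]` is an isomorphism. -/
def IsOfLinearType (I : Ideal A) : Prop :=
  Function.Bijective (SymmetricAlgebra.lift (toReesDegreeOne I))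

/-- `a₁, …, a_m` is a `d`-sequence: `((a₁, …, a_{i-1}) : a_i) ∩ I = (a₁, …, a_{i-1})` for all `i`,
where `I = (a₁, …, a_m)`. -/
def IsDSequence {m : ℕ} (a : Fin m → A) : Prop :=
  ∀ i : Fin m, {z : A | z * a i ∈ Ideal.span (a '' Set.Iio i)} ∩ Ideal.span (Set.range a) =
    (Ideal.span (a '' Set.Iio i) : Set A)

end Ideals

/-! ### Paths of a cycle as complements of edges -/

section CyclePaths

/-! A path on `n - 2` vertices of `C_n` is the complement of an edge, so the generators are the
products `f_j` of all variables except `x_j, x_{j+1}`. The identity `x_j f_j = x_{j+2} f_{j+1}`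
gives linear relations `ρ_j = x_j y_j - x_{j+2} y_{j+1}` of the Rees algebra. Everything rests on
two facts about them, both using that `n` is odd, so that steps of length 2 reach every vertex.

(a) The `ρ_j` generate the toric ideal of the Rees algebra (`ker_cycleRees`). Two monomials with the
same image are connected by moving the `y`-factors, viewed as tokens on the cycle, by induction on
the number of tokens. Linear type follows, since the `ρ_j` already vanish in `Sym(I)`.

(b) Modulo `x`, every syzygy of the `ρ_j` is a multiple of `(q_j)`, where `q_j = y_{j+2} y_{j+4} ⋯
y_{j+2r}` (`exists_evalXZero_eq_of_syzygy`), and `(q_j)` is itself a syzygy, of bidegree `(1, r+1)`.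
It accounts for all syzygies of `x`-degree 1, so it is a minimal generator. Thus `Tor_2` is nonzero
in `y`-degree `r+1`, and `reg_y ≥ r-1`.

Suppose now that a `d`-sequence `a_i` generates `I`. Its colon condition passes to the elements `θ_i
= a_i t` acting on the ideal `P` of elements of positive `t`-degree
(`reesAlgebra_mem_span_of_mul_mem`). Hence every second Koszul cycle on the `θ_i` with coefficients
in `P` lifts to a Koszul cycle over `S` (`koszul_two_cycle_lift`). But `z = ∑ x_l y_{l+4} ⋯ y_{l+2r}
e_l ∧ e_{l+2}` is a cycle over the Rees algebra, with coefficients in `P` because `r ≥ 2`, and it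
does not lift: by (b), a lift would give `∑ c_l y_l = 1` (`cycleChain_not_liftable`). -/

theorem Fin.val_nsmul_one (m k : ℕ) : ((k • (1 : Fin (m + 1))).val) = k % (m + 1) := by
  induction k with
  | zero => simp
  | succ k ih => rw [succ_nsmul, Fin.val_add, ih]; simp [Nat.add_mod]

theorem Fin.nsmul_one_eq_zero_iff {m k : ℕ} : k • (1 : Fin (m + 1)) = 0 ↔ m + 1 ∣ k := by
  rw [Fin.ext_iff, Fin.val_nsmul_one, Fin.val_zero, Nat.dvd_iff_mod_eq_zero]

theorem Fin.nsmul_one_inj {m i j : ℕ} (hi : i < m + 1) (hj : j < m + 1)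
    (h : i • (1 : Fin (m + 1)) = j • (1 : Fin (m + 1))) : i = j := by
  have h1 := congrArg Fin.val h
  rwa [Fin.val_nsmul_one, Fin.val_nsmul_one, Nat.mod_eq_of_lt hi, Nat.mod_eq_of_lt hj] at h1

theorem Fin.exists_add_nsmul_one {m : ℕ} (i j : Fin (m + 1)) : ∃ k < m + 1, j = i + k • (1 : Fin (m + 1)) :=
  ⟨(j - i).val, (j - i).isLt, by
    have : (j - i).val • (1 : Fin (m + 1)) = j - i := by
      rw [Fin.ext_iff, Fin.val_nsmul_one, Nat.mod_eq_of_lt (j - i).isLt]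
    rw [this]; abel⟩

theorem Fin.add_nsmul_one_ne {m k : ℕ} (j : Fin (m + 1)) (h0 : 0 < k) (h1 : k < m + 1) :
    j + k • (1 : Fin (m + 1)) ≠ j := fun h => by
  rw [add_eq_left, Fin.nsmul_one_eq_zero_iff] at h
  exact absurd (Nat.le_of_dvd h0 h) (by omega)

theorem cycleGraph_adj_iff_eq {m : ℕ} {u v : Fin (m + 3)} :
    (SimpleGraph.cycleGraph (m + 3)).Adj u v ↔ v = u + 1 ∨ v = u - 1 := by
  rw [SimpleGraph.cycleGraph_adj]
  constructor
  · rintro (h | h)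
    · right; rw [← h]; abel
    · left; rw [← h]; abel
  · rintro (h | h)
    · right; rw [h]; abel
    · left; rw [h]; abel

/-- Reversing direction would revisit the vertex just left, so a path keeps one direction `s = ±1`.
-/
theorem cycleGraph_path_support {m : ℕ} {v w : Fin (m + 3)}
    (p : (SimpleGraph.cycleGraph (m + 3)).Walk v w) (hp : p.IsPath) :
    ∃ s : Fin (m + 3), (s = 1 ∨ s = -1) ∧
      p.support = (List.range p.support.length).map (fun i => v + i • s) := by
  induction p with
  | nil => exact ⟨1, Or.inl rfl, by simp⟩
  | @cons u v w h p ih =>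
    rw [SimpleGraph.Walk.cons_isPath_iff] at hp
    obtain ⟨s, hs, hsupp⟩ := ih hp.1
    rw [cycleGraph_adj_iff_eq] at h
    -- A one-vertex tail has no direction of its own, so the new edge supplies it. A longer tail
    -- already contains `v + s`, which therefore cannot be `u`.
    have key : ∃ s' : Fin (m + 3), (s' = 1 ∨ s' = -1) ∧ v = u + s' ∧
        (s' = s ∨ p.support.length = 1) := by
      by_cases hl : p.support.length = 1
      · rcases h with h | h
        · exact ⟨1, Or.inl rfl, h, Or.inr hl⟩
        · exact ⟨-1, Or.inr rfl, by rw [h]; abel, Or.inr hl⟩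
      · have h2 : 1 < p.support.length := by
          have : p.support.length ≠ 0 := by simp
          omega
        have hne : u ≠ v + s := by
          intro hu
          apply hp.2
          rw [hsupp, List.mem_map]
          exact ⟨1, List.mem_range.2 h2, by simp [hu]⟩
        refine ⟨s, hs, ?_, Or.inl rfl⟩
        rcases hs with rfl | rfl <;> rcases h with h | h
        · exact h
        · exact absurd (by rw [h]; abel) hne
        · exact absurd (by rw [h]; abel) hne
        · rw [h]; abel
    obtain ⟨s', hs', hv, hss⟩ := key
    refine ⟨s', hs', ?_⟩
    rw [SimpleGraph.Walk.support_cons, List.length_cons, List.range_succ_eq_map, List.map_cons,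
      List.map_map]
    congr 1
    · simp
    · rcases hss with rfl | hl
      · conv_lhs => rw [hsupp]
        refine List.map_congr_left fun i _ => ?_
        simp only [Function.comp, Nat.succ_eq_add_one, succ_nsmul, hv]
        abel
      · rw [hsupp, hl]
        simp [hv]

theorem cycleGraph_exists_walk {m : ℕ} (l : ℕ) (v : Fin (m + 3)) :
    ∃ (w : Fin (m + 3)) (p : (SimpleGraph.cycleGraph (m + 3)).Walk v w),
      p.support = (List.range (l + 1)).map (fun i => v + i • (1 : Fin (m + 3))) := by
  induction l generalizing v with
  | zero => exact ⟨v, .nil, by simp⟩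
  | succ l ih =>
    obtain ⟨w, p, hp⟩ := ih (v + 1)
    refine ⟨w, .cons (cycleGraph_adj_iff_eq.2 (Or.inl rfl)) p, ?_⟩
    rw [SimpleGraph.Walk.support_cons, hp, List.range_succ_eq_map (n := l + 1), List.map_cons,
      List.map_map]
    congr 1
    · simp
    · refine List.map_congr_left fun i _ => ?_
      simp only [Function.comp, Nat.succ_eq_add_one, succ_nsmul]
      abel

/-- The squarefree monomial missing exactly the variables `x_j` and `x_{j+1}`. -/
noncomputable def edgeComplMonomial (K : Type u) [Field K] {m : ℕ} (j : Fin (m + 1)) :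
    MvPolynomial (Fin (m + 1)) K :=
  ∏ v ∈ ({j, j + 1} : Finset (Fin (m + 1)))ᶜ, MvPolynomial.X v

/-- The `m + 1` vertices listed omit exactly `v + (m+1)s` and `v + (m+2)s`, which are adjacent. The
clause for `s = 1` pins down `j`, so that every edge is seen to occur. -/
theorem edgeComplMonomial_eq_prod_range (K : Type u) [Field K] {m : ℕ} (v s : Fin (m + 3))
    (hs : s = 1 ∨ s = -1) :
    ∃ j : Fin (m + 3), (s = 1 → j + 1 + 1 = v) ∧
      (((List.range (m + 1)).map (fun i => v + i • s)).map MvPolynomial.X).prod =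
        edgeComplMonomial K j := by
  have hinj : ∀ i < m + 3, ∀ k < m + 3, v + i • s = v + k • s → i = k := by
    intro i hi k hk h
    rw [add_right_inj] at h
    rcases hs with rfl | rfl
    · exact Fin.nsmul_one_inj hi hk h
    · rw [smul_neg, smul_neg, neg_inj] at h
      exact Fin.nsmul_one_inj hi hk h
  have hpair : ∃ j : Fin (m + 3), (s = 1 → j + 1 + 1 = v) ∧
      ({j, j + 1} : Finset (Fin (m + 3))) = {v + (m + 1) • s, v + (m + 2) • s} := by
    have h0 : (m + 3) • s = 0 := by
      rcases hs with rfl | rfl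
      · exact Fin.nsmul_one_eq_zero_iff.2 dvd_rfl
      · rw [smul_neg, neg_eq_zero]; exact Fin.nsmul_one_eq_zero_iff.2 dvd_rfl
    have h1 : v + (m + 2) • s + s = v := by
      rw [add_assoc, ← succ_nsmul, h0, add_zero]
    have h2 : v + (m + 2) • s = v + (m + 1) • s + s := by
      rw [succ_nsmul s (m + 1), add_assoc]
    by_cases h : s = 1
    · subst h
      exact ⟨v + (m + 1) • 1, fun _ => by rw [← h2, h1], by rw [h2]⟩
    · obtain rfl : s = -1 := hs.resolve_left h
      refine ⟨v + (m + 2) • (-1), fun h' => absurd h' h, ?_⟩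
      rw [Finset.pair_comm, h2]
      congr 1
      abel
  obtain ⟨j, hj, hp⟩ := hpair
  refine ⟨j, hj, ?_⟩
  rw [edgeComplMonomial, hp, List.map_map]
  have hset : (Finset.range (m + 1)).image (fun i => v + i • s) =
      ({v + (m + 1) • s, v + (m + 2) • s} : Finset (Fin (m + 3)))ᶜ := by
    apply Finset.eq_of_subset_of_card_le
    · intro x hx
      obtain ⟨i, hi, rfl⟩ := Finset.mem_image.1 hx
      rw [Finset.mem_range] at hi
      rw [Finset.mem_compl, Finset.mem_insert, Finset.mem_singleton]
      rintro (h | h)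
      · have := hinj _ (by omega) _ (by omega) h; omega
      · have := hinj _ (by omega) _ (by omega) h; omega
    · rw [Finset.card_compl, Finset.card_pair, Finset.card_image_of_injOn]
      · simp
      · intro i hi k hk h
        simp only [Finset.coe_range, Set.mem_Iio] at hi hk
        exact hinj _ (by omega) _ (by omega) h
      · intro h
        have := hinj _ (by omega) _ (by omega) h; omega
  rw [← hset, Finset.prod_image]
  · rfl
  · intro i hi k hk h
    simp only [Finset.coe_range, Set.mem_Iio] at hi hk
    exact hinj _ (by omega) _ (by omega) h

theorem pathMonomials_cycleGraph (K : Type u) [Field K] (m : ℕ) :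
    pathMonomials K (SimpleGraph.cycleGraph (m + 3)) (m + 1) =
      Set.range (edgeComplMonomial K : Fin (m + 3) → _) := by
  ext f
  constructor
  · rintro ⟨v, w, p, hp, hl, rfl⟩
    obtain ⟨s, hs, hsupp⟩ := cycleGraph_path_support p hp
    rw [hl] at hsupp
    obtain ⟨j, -, hj⟩ := edgeComplMonomial_eq_prod_range K v s hs
    exact ⟨j, by rw [hsupp, hj]⟩
  · rintro ⟨j, rfl⟩
    obtain ⟨w, p, hp⟩ := cycleGraph_exists_walk (m := m) m (j + 1 + 1)
    obtain ⟨j', h1, h2⟩ := edgeComplMonomial_eq_prod_range K (j + 1 + 1) 1 (Or.inl rfl)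
    obtain rfl : j' = j := by simpa using h1 rfl
    refine ⟨_, w, p, ?_, by simp [hp], by rw [hp, h2]⟩
    rw [SimpleGraph.Walk.isPath_def, hp]
    refine List.Nodup.map_on ?_ List.nodup_range
    intro i hi k hk h
    rw [List.mem_range] at hi hk
    exact Fin.nsmul_one_inj (by omega) (by omega) (add_left_cancel h)

theorem edgeComplMonomial_eq_monomial (K : Type u) [Field K] {m : ℕ} (j : Fin (m + 1)) :
    edgeComplMonomial K j = MvPolynomial.monomial
      (∑ v ∈ ({j, j + 1} : Finset (Fin (m + 1)))ᶜ, Finsupp.single v 1) 1 := by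
  rw [MvPolynomial.monomial_sum_one]
  rfl

theorem edgeComplExponent_apply {m : ℕ} (j v : Fin (m + 1)) :
    (∑ v ∈ ({j, j + 1} : Finset (Fin (m + 1)))ᶜ, Finsupp.single v 1 : Fin (m + 1) →₀ ℕ) v =
      if v = j ∨ v = j + 1 then 0 else 1 := by
  rw [Finsupp.finsetSum_apply]
  simp only [Finsupp.single_apply, Finset.sum_ite_eq', Finset.mem_compl, Finset.mem_insert,
    Finset.mem_singleton]
  split_ifs <;> simp_all

/-- Equal complements of distinct edges would give `i = j + 1` and `j = i + 1`, hence `2 = 0`, which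
fails on at least three vertices. This lets `y`-variables indexed by generators be indexed by
vertices. -/
theorem edgeComplMonomial_injective (K : Type u) [Field K] (m : ℕ) :
    Function.Injective (edgeComplMonomial K : Fin (m + 3) → _) := by
  intro i j h
  rw [edgeComplMonomial_eq_monomial, edgeComplMonomial_eq_monomial] at h
  have h' := MvPolynomial.monomial_left_injective (one_ne_zero) h
  have h1 := DFunLike.congr_fun h' i
  have h2 := DFunLike.congr_fun h' (i + 1)
  rw [edgeComplExponent_apply, edgeComplExponent_apply] at h1 h2
  simp only [true_or, or_true, if_true] at h1 h2
  by_contra hne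
  have h3 : i = j + 1 := by
    by_contra h3
    simp [hne, h3] at h1
  have h4 : i + 1 = j := by
    by_contra h4
    simp [hne, h4] at h2
  rw [h3] at h4
  have := Fin.add_nsmul_one_ne (m := m + 2) (k := 2) j (by omega) (by omega)
  apply this
  rw [two_nsmul, ← add_assoc]
  exact h4

end CyclePaths

/-! ### The Rees ideal is generated by the linear relations -/

section ToricKernel

/-- The functional `cf k` sums the coefficients over the fibre of `im` at `k`. If all sums vanish, a
monomial of the support has a partner in its fibre, and subtracting a multiple of their binomial
shrinks the support. -/
theorem MvPolynomial.mem_of_binomials_mem {K : Type*} [Field K] {ι κ : Type*} [DecidableEq κ]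
    (L : Ideal (MvPolynomial ι K)) (im : (ι →₀ ℕ) → κ)
    (hL : ∀ s s', im s = im s' → monomial s (1 : K) - monomial s' 1 ∈ L)
    (cf : κ → MvPolynomial ι K →ₗ[K] K)
    (hcf : ∀ k s, cf k (monomial s 1) = if im s = k then 1 else 0)
    (p : MvPolynomial ι K) (hp : ∀ k, cf k p = 0) : p ∈ L := by
  classical
  induction hn : p.support.card using Nat.strong_induction_on generalizing p with
  | _ n ih =>
    by_cases h0 : p = 0
    · rw [h0]; exact L.zero_mem
    obtain ⟨s, hs⟩ := MvPolynomial.support_nonempty.2 h0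
    have hsum : cf (im s) p = ∑ t ∈ p.support, p.coeff t * (if im t = im s then 1 else 0) := by
      conv_lhs => rw [p.as_sum, map_sum]
      refine Finset.sum_congr rfl fun t _ => ?_
      rw [← hcf, ← smul_eq_mul, ← map_smul, smul_monomial, smul_eq_mul, mul_one]
    obtain ⟨t, ht, hts, him⟩ : ∃ t ∈ p.support, t ≠ s ∧ im t = im s := by
      by_contra! hcon
      rw [hp, Finset.sum_eq_single s] at hsum
      · simp only [if_true, mul_one] at hsum
        exact (mem_support_iff.1 hs) hsum.symm
      · intro t ht hts
        rw [if_neg (hcon t ht hts), mul_zero]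
      · exact fun h => absurd hs h
    have hmem : p.coeff s • (monomial s (1 : K) - monomial t 1) ∈ L := by
      rw [smul_eq_C_mul]
      exact L.mul_mem_left _ (hL s t him.symm)
    have hrec : p - p.coeff s • (monomial s (1 : K) - monomial t 1) ∈ L := by
      refine ih _ ?_ _ ?_ rfl
      · rw [← hn]
        apply Finset.card_lt_card
        rw [Finset.ssubset_iff_of_subset]
        · refine ⟨s, hs, ?_⟩
          simp [coeff_monomial, hts]
        · intro x hx
          by_contra hxp
          have h1 : x ≠ s := fun h => hxp (h ▸ hs)
          have h2 : x ≠ t := fun h => hxp (h ▸ ht)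
          rw [notMem_support_iff] at hxp
          rw [mem_support_iff] at hx
          apply hx
          simp [coeff_monomial, h1.symm, h2.symm, hxp]
      · intro k
        rw [map_sub, map_smul, map_sub, hcf, hcf, him, sub_self, smul_zero, hp, sub_zero]
    simpa using L.add_mem hrec hmem

variable (K : Type u) [Field K] {m : ℕ}

/-- The presentation of the Rees algebra of the ideal of the monomials `edgeComplMonomial`, with
values in `B[t]`. -/
noncomputable def cycleRees :
    MvPolynomial (Fin (m + 1) ⊕ Fin (m + 1)) K →ₐ[K] Polynomial (MvPolynomial (Fin (m + 1)) K) :=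
  MvPolynomial.aeval (Sum.elim (fun v => Polynomial.C (MvPolynomial.X v))
    (fun j => Polynomial.monomial 1 (edgeComplMonomial K j)))

/-- The linear relation `x_j y_j - x_{j+2} y_{j+1}` of the Rees algebra. -/
noncomputable def cycleRelation (j : Fin (m + 1)) :
    MvPolynomial (Fin (m + 1) ⊕ Fin (m + 1)) K :=
  MvPolynomial.X (Sum.inl j) * MvPolynomial.X (Sum.inr j) -
    MvPolynomial.X (Sum.inl (j + 1 + 1)) * MvPolynomial.X (Sum.inr (j + 1))

variable (m) in
/-- The ideal generated by the linear relations of the Rees algebra. -/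
noncomputable def cycleRelationIdeal :
    Ideal (MvPolynomial (Fin (m + 1) ⊕ Fin (m + 1)) K) :=
  Ideal.span (Set.range (cycleRelation K))

/-- The exponents of the image of a monomial under `cycleRees`. -/
noncomputable def cycleWeight :
    ((Fin (m + 1) ⊕ Fin (m + 1)) →₀ ℕ) →+ ℕ × (Fin (m + 1) →₀ ℕ) :=
  Finsupp.weight (Sum.elim (fun v => (0, Finsupp.single v 1))
    (fun j => (1, ∑ v ∈ ({j, j + 1} : Finset (Fin (m + 1)))ᶜ, Finsupp.single v 1)))

theorem cycleRees_monomial (s : (Fin (m + 1) ⊕ Fin (m + 1)) →₀ ℕ) :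
    cycleRees K (MvPolynomial.monomial s 1) =
      Polynomial.monomial (cycleWeight s).1 (MvPolynomial.monomial (cycleWeight s).2 1) := by
  induction s using Finsupp.induction_linear with
  | zero => simp
  | add s t hs ht =>
    have : MvPolynomial.monomial (s + t) (1 : K) =
        MvPolynomial.monomial s 1 * MvPolynomial.monomial t 1 := by
      rw [MvPolynomial.monomial_mul, one_mul]
    rw [this, map_mul, hs, ht, Polynomial.monomial_mul_monomial, MvPolynomial.monomial_mul, map_add,
      one_mul]
    rfl
  | single i k =>
    rw [← MvPolynomial.X_pow_eq_monomial, map_pow, cycleRees, MvPolynomial.aeval_X, cycleWeight,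
      Finsupp.weight_single]
    rcases i with v | j
    · simp only [Sum.elim_inl, Prod.smul_mk, Finsupp.smul_single, smul_eq_mul, mul_one]
      rw [← map_pow, MvPolynomial.X_pow_eq_monomial, mul_zero, Polynomial.monomial_zero_left]
    · simp only [Sum.elim_inr, Prod.smul_mk, smul_eq_mul, mul_one]
      rw [Polynomial.monomial_pow, one_mul, edgeComplMonomial_eq_monomial, MvPolynomial.monomial_pow,
        one_pow]

theorem cycleWeight_fst (s : (Fin (m + 1) ⊕ Fin (m + 1)) →₀ ℕ) :
    (cycleWeight s).1 = ∑ j, s (Sum.inr j) := by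
  rw [cycleWeight, Finsupp.weight_apply, Finsupp.sum_fintype _ _ (by simp), Prod.fst_sum]
  simp

/-- The variable `x_{v+1}` divides `f_j` unless `j = v` or `j = v + 1`, whence the two subtracted
terms; `1 ≤ m` keeps these two indices distinct. -/
theorem cycleWeight_snd (s : (Fin (m + 1) ⊕ Fin (m + 1)) →₀ ℕ) (hm : 1 ≤ m) (v : Fin (m + 1)) :
    (((cycleWeight s).2 (v + 1) : ℕ) : ℤ) =
      s (Sum.inl (v + 1)) + (∑ j, (s (Sum.inr j) : ℤ)) - s (Sum.inr v) - s (Sum.inr (v + 1)) := by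
  have h1 : (cycleWeight s).2 (v + 1) = s (Sum.inl (v + 1)) +
      ∑ j, s (Sum.inr j) * (if v + 1 = j ∨ v + 1 = j + 1 then 0 else 1) := by
    rw [cycleWeight, Finsupp.weight_apply, Finsupp.sum_fintype _ _ (by simp), Prod.snd_sum,
      Finsupp.finsetSum_apply, Fintype.sum_sum_type]
    congr 1
    · simp [Finsupp.single_apply]
    · refine Finset.sum_congr rfl fun j _ => ?_
      simp only [Sum.elim_inr, Prod.smul_mk, Finsupp.smul_apply]
      rw [edgeComplExponent_apply, smul_eq_mul]
  have hne : v ≠ v + 1 := by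
    have := Fin.add_nsmul_one_ne (k := 1) v (by omega) (by omega)
    rw [one_nsmul] at this
    exact this.symm
  have h2 : ∑ j, (s (Sum.inr j) : ℤ) * (if v + 1 = j ∨ v + 1 = j + 1 then 0 else 1) =
      ∑ j, ((s (Sum.inr j) : ℤ) - (if j = v then (s (Sum.inr j) : ℤ) else 0) -
        (if j = v + 1 then (s (Sum.inr j) : ℤ) else 0)) := by
    refine Finset.sum_congr rfl fun j _ => ?_
    simp only [add_left_inj]
    by_cases ha : j = v
    · have : ¬ j = v + 1 := fun h => hne (ha ▸ h)
      simp [ha, hne]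
    · by_cases hb : j = v + 1
      · simp [hb, hne.symm]
      · simp [ha, hb, Ne.symm ha, Ne.symm hb]
  rw [h1]
  push_cast
  rw [h2]
  simp only [Finset.sum_sub_distrib, Finset.sum_ite_eq', Finset.mem_univ, if_true]
  ring

/-- Two monomials in `K[x, y]` have the same image in the Rees algebra. -/
def SameWeight (s t : (Fin (m + 1) ⊕ Fin (m + 1)) →₀ ℕ) : Prop :=
  ∑ j, s (Sum.inr j) = ∑ j, t (Sum.inr j) ∧
    ∀ v, (s (Sum.inl (v + 1)) : ℤ) - s (Sum.inr v) - s (Sum.inr (v + 1)) =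
      t (Sum.inl (v + 1)) - t (Sum.inr v) - t (Sum.inr (v + 1))

theorem sameWeight_of_cycleWeight_eq (hm : 1 ≤ m) {s t : (Fin (m + 1) ⊕ Fin (m + 1)) →₀ ℕ}
    (h : cycleWeight s = cycleWeight t) : SameWeight s t := by
  have h1 : ∑ j, s (Sum.inr j) = ∑ j, t (Sum.inr j) := by
    rw [← cycleWeight_fst, ← cycleWeight_fst, h]
  refine ⟨h1, fun v => ?_⟩
  have hs := cycleWeight_snd s hm v
  have ht := cycleWeight_snd t hm v
  have h2 : ∑ j, (s (Sum.inr j) : ℤ) = ∑ j, (t (Sum.inr j) : ℤ) := by exact_mod_cast h1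
  rw [h, ht, h2] at hs
  linarith

theorem SameWeight.symm {s t : (Fin (m + 1) ⊕ Fin (m + 1)) →₀ ℕ} (h : SameWeight s t) :
    SameWeight t s := ⟨h.1.symm, fun v => (h.2 v).symm⟩

theorem SameWeight.trans {s t w : (Fin (m + 1) ⊕ Fin (m + 1)) →₀ ℕ} (h : SameWeight s t)
    (h' : SameWeight t w) : SameWeight s w :=
  ⟨h.1.trans h'.1, fun v => (h.2 v).trans (h'.2 v)⟩

/-- Two monomials of `K[x, y]` agree modulo the linear relations. -/
def CycleEquiv (s t : (Fin (m + 1) ⊕ Fin (m + 1)) →₀ ℕ) : Prop :=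
  MvPolynomial.monomial s (1 : K) - MvPolynomial.monomial t 1 ∈ cycleRelationIdeal K m

variable {K}

theorem CycleEquiv.symm {s t : (Fin (m + 1) ⊕ Fin (m + 1)) →₀ ℕ} (h : CycleEquiv K s t) :
    CycleEquiv K t s := by
  have := (cycleRelationIdeal K m).neg_mem h
  rwa [neg_sub] at this

theorem CycleEquiv.trans {s t w : (Fin (m + 1) ⊕ Fin (m + 1)) →₀ ℕ} (h : CycleEquiv K s t)
    (h' : CycleEquiv K t w) : CycleEquiv K s w := by
  have := (cycleRelationIdeal K m).add_mem h h'
  rwa [sub_add_sub_cancel] at this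

theorem CycleEquiv.add {s t : (Fin (m + 1) ⊕ Fin (m + 1)) →₀ ℕ} (h : CycleEquiv K s t)
    (w : (Fin (m + 1) ⊕ Fin (m + 1)) →₀ ℕ) : CycleEquiv K (s + w) (t + w) := by
  have := (cycleRelationIdeal K m).mul_mem_right (MvPolynomial.monomial w 1) h
  rwa [sub_mul, MvPolynomial.monomial_mul, MvPolynomial.monomial_mul, one_mul] at this

theorem cycleEquiv_step (j : Fin (m + 1)) :
    CycleEquiv K (Finsupp.single (Sum.inl j) 1 + Finsupp.single (Sum.inr j) 1)
      (Finsupp.single (Sum.inl (j + 1 + 1)) 1 + Finsupp.single (Sum.inr (j + 1)) 1) := by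
  have : cycleRelation K j ∈ cycleRelationIdeal K m := Ideal.subset_span ⟨j, rfl⟩
  rw [cycleRelation] at this
  simp only [MvPolynomial.X, MvPolynomial.monomial_mul, one_mul] at this
  exact this

theorem SameWeight.add_iff {s t : (Fin (m + 1) ⊕ Fin (m + 1)) →₀ ℕ}
    (w : (Fin (m + 1) ⊕ Fin (m + 1)) →₀ ℕ) : SameWeight (s + w) (t + w) ↔ SameWeight s t := by
  unfold SameWeight
  simp only [Finsupp.add_apply, Finset.sum_add_distrib, add_left_inj]
  refine and_congr_right fun _ => forall_congr' fun v => ?_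
  push_cast
  constructor <;> intro h <;> linarith

theorem sameWeight_step (j : Fin (m + 1)) :
    SameWeight (Finsupp.single (Sum.inl j) 1 + Finsupp.single (Sum.inr j) 1)
      (Finsupp.single (Sum.inl (j + 1 + 1)) 1 + Finsupp.single (Sum.inr (j + 1)) 1) := by
  constructor
  · simp [Finsupp.single_apply]
  · intro v
    have e1 : (j + 1 = v + 1) ↔ (j = v) := add_left_inj _
    have e2 : (j + 1 + 1 = v + 1) ↔ (j + 1 = v) := add_left_inj _
    simp only [Finsupp.add_apply, Finsupp.single_apply, Sum.inl.injEq, Sum.inr.injEq, e1, e2,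
      reduceCtorEq, if_false]
    push_cast
    ring

/-- A token at `j` moves to `j + 1`, using `x_j`. -/
theorem exists_move_right {s : (Fin (m + 1) ⊕ Fin (m + 1)) →₀ ℕ} {j : Fin (m + 1)}
    (hx : 0 < s (Sum.inl j)) (hy : 0 < s (Sum.inr j)) :
    ∃ t, CycleEquiv K s t ∧ SameWeight s t ∧ 0 < t (Sum.inr (j + 1)) := by
  have hle : Finsupp.single (Sum.inl j) 1 + Finsupp.single (Sum.inr j) 1 ≤ s := by
    intro i
    rcases i with i | i
    · simp only [Finsupp.add_apply, Finsupp.single_apply, Sum.inl.injEq, reduceCtorEq, if_false]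
      split_ifs with h
      · subst h; omega
      · omega
    · simp only [Finsupp.add_apply, Finsupp.single_apply, Sum.inr.injEq, reduceCtorEq, if_false]
      split_ifs with h
      · subst h; omega
      · omega
  obtain ⟨w, rfl⟩ := exists_add_of_le hle
  exact ⟨_, (cycleEquiv_step j).add w, (SameWeight.add_iff w).2 (sameWeight_step j), by simp⟩

/-- A token at `j + 1` moves to `j`, using `x_{j+2}`. -/
theorem exists_move_left {s : (Fin (m + 1) ⊕ Fin (m + 1)) →₀ ℕ} {j : Fin (m + 1)}
    (hx : 0 < s (Sum.inl (j + 1 + 1))) (hy : 0 < s (Sum.inr (j + 1))) :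
    ∃ t, CycleEquiv K s t ∧ SameWeight s t ∧ 0 < t (Sum.inr j) := by
  have hle : Finsupp.single (Sum.inl (j + 1 + 1)) 1 + Finsupp.single (Sum.inr (j + 1)) 1 ≤ s := by
    intro i
    rcases i with i | i
    · simp only [Finsupp.add_apply, Finsupp.single_apply, Sum.inl.injEq, reduceCtorEq, if_false]
      split_ifs with h
      · subst h; omega
      · omega
    · simp only [Finsupp.add_apply, Finsupp.single_apply, Sum.inr.injEq, reduceCtorEq, if_false]
      split_ifs with h
      · subst h; omega
      · omega
  obtain ⟨w, rfl⟩ := exists_add_of_le hle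
  exact ⟨_, (cycleEquiv_step j).symm.add w, (SameWeight.add_iff w).2 (sameWeight_step j).symm,
    by simp⟩

/-- Cancelling a shared `y_j` lowers the number of tokens. It therefore suffices afterwards to
create a shared token by moves. -/
theorem cycleEquiv_of_common {N : ℕ}
    (ih : ∀ s t : (Fin (m + 1) ⊕ Fin (m + 1)) →₀ ℕ, SameWeight s t → ∑ j, s (Sum.inr j) = N →
      CycleEquiv K s t)
    {s t : (Fin (m + 1) ⊕ Fin (m + 1)) →₀ ℕ} (h : SameWeight s t)
    (hN : ∑ j, s (Sum.inr j) = N + 1) {j : Fin (m + 1)} (hs : 0 < s (Sum.inr j))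
    (ht : 0 < t (Sum.inr j)) : CycleEquiv K s t := by
  have hs' : Finsupp.single (Sum.inr j) 1 ≤ s := by
    rw [Finsupp.single_le_iff]; exact hs
  have ht' : Finsupp.single (Sum.inr j) 1 ≤ t := by
    rw [Finsupp.single_le_iff]; exact ht
  obtain ⟨s, rfl⟩ := exists_add_of_le hs'
  obtain ⟨t, rfl⟩ := exists_add_of_le ht'
  rw [add_comm, add_comm _ t] at h ⊢
  refine (ih s t ((SameWeight.add_iff _).1 h) ?_).add _
  simp only [Finsupp.add_apply, Finset.sum_add_distrib] at hN
  simp only [Finsupp.single_apply, Sum.inr.injEq, Finset.sum_ite_eq, Finset.mem_univ,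
    if_true] at hN
  omega

/-- Oddness enters here. If no shared token can be created, the pattern "`s` at `i`, `t` at `i + 1`"
repeats at `i + 2`, and going round the odd cycle brings a token of `s` to `j + 1`, where `t` has
one. -/
theorem cycleEquiv_of_adjacent {r N : ℕ} (hm : m = 2 * r)
    (ih : ∀ s t : (Fin (m + 1) ⊕ Fin (m + 1)) →₀ ℕ, SameWeight s t → ∑ j, s (Sum.inr j) = N →
      CycleEquiv K s t)
    {s t : (Fin (m + 1) ⊕ Fin (m + 1)) →₀ ℕ} (h : SameWeight s t)
    (hN : ∑ j, s (Sum.inr j) = N + 1) {j : Fin (m + 1)} (hs : 0 < s (Sum.inr j))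
    (ht : 0 < t (Sum.inr (j + 1))) : CycleEquiv K s t := by
  by_contra hcon
  have hcommon : ∀ i, 0 < s (Sum.inr i) → t (Sum.inr i) = 0 := by
    intro i hi
    by_contra hi'
    exact hcon (cycleEquiv_of_common ih h hN hi (Nat.pos_of_ne_zero hi'))
  have step : ∀ i, 0 < s (Sum.inr i) ∧ 0 < t (Sum.inr (i + 1)) →
      0 < s (Sum.inr (i + 1 + 1)) ∧ 0 < t (Sum.inr (i + 1 + 1 + 1)) := by
    rintro i ⟨hi, hi1⟩
    -- Otherwise equality of weights at `x_{i+2}` makes this variable divide `t`, and the token of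
    -- `t` at `i + 1` moves left onto that of `s` at `i`. The second half is the same with the roles
    -- exchanged, one vertex further.
    have hs2 : 0 < s (Sum.inr (i + 1 + 1)) := by
      by_contra hneg
      have hx : 0 < t (Sum.inl (i + 1 + 1)) := by
        have h2 := h.2 (i + 1)
        have h3 : s (Sum.inr (i + 1)) = 0 := by
          by_contra h3
          have := hcommon _ (Nat.pos_of_ne_zero h3)
          omega
        omega
      obtain ⟨t', e, w, h'⟩ := exists_move_left (K := K) hx hi1
      exact hcon ((cycleEquiv_of_common ih (h.trans w) hN hi h').trans e.symm)
    refine ⟨hs2, ?_⟩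
    by_contra hneg
    have hx : 0 < s (Sum.inl (i + 1 + 1 + 1)) := by
      have h2 := h.2 (i + 1 + 1)
      have h3 := hcommon _ hs2
      omega
    obtain ⟨s', e, w, h'⟩ := exists_move_left (K := K) hx hs2
    exact hcon (e.trans (cycleEquiv_of_common ih (w.symm.trans h) (w.1 ▸ hN) h' hi1))
  have all : ∀ k : ℕ, 0 < s (Sum.inr (j + (2 * k) • (1 : Fin (m + 1)))) ∧
      0 < t (Sum.inr (j + (2 * k) • (1 : Fin (m + 1)) + 1)) := by
    intro k
    induction k with
    | zero => simpa using ⟨hs, ht⟩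
    | succ k hk =>
      have e : j + (2 * (k + 1)) • (1 : Fin (m + 1)) = j + (2 * k) • (1 : Fin (m + 1)) + 1 + 1 := by
        rw [mul_add, add_nsmul, mul_one, two_nsmul]; abel
      rw [e]
      exact step _ hk
  have h1 := (all (r + 1)).1
  have e : j + (2 * (r + 1)) • (1 : Fin (m + 1)) = j + 1 := by
    have : 2 * (r + 1) = (m + 1) + 1 := by omega
    rw [this, add_nsmul, Fin.nsmul_one_eq_zero_iff.2 dvd_rfl, zero_add, one_nsmul]
  rw [e] at h1
  have := hcommon _ h1
  omega

/-- For fixed `N`, the inner induction is on the distance `k` from a token of `s` to a token of `t`.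
With no token of `t` at `j` or `j + 1`, one at `j - 1` can be met by a left move of `s`. With none
at `j - 1` or `j`, the variable `x_j` divides `s`, and a right move shortens the distance. -/
theorem cycleEquiv_of_sameWeight {r : ℕ} (hm : m = 2 * r) (N : ℕ) :
    ∀ s t : (Fin (m + 1) ⊕ Fin (m + 1)) →₀ ℕ, SameWeight s t → ∑ j, s (Sum.inr j) = N →
      CycleEquiv K s t := by
  induction N with
  | zero =>
    intro s t h hN
    have h1 : ∀ j, s (Sum.inr j) = 0 := fun j => by
      rw [Finset.sum_eq_zero_iff] at hN
      exact hN j (Finset.mem_univ _)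
    have h2 : ∀ j, t (Sum.inr j) = 0 := fun j => by
      rw [h.1, Finset.sum_eq_zero_iff] at hN
      exact hN j (Finset.mem_univ _)
    have : s = t := by
      ext i
      rcases i with i | i
      · have := h.2 (i - 1)
        simp only [h1, h2, sub_add_cancel] at this
        omega
      · rw [h1, h2]
    rw [this, CycleEquiv, sub_self]
    exact Ideal.zero_mem _
  | succ N ih =>
    have claim : ∀ k : ℕ, ∀ (s t : (Fin (m + 1) ⊕ Fin (m + 1)) →₀ ℕ), SameWeight s t →
        ∑ j, s (Sum.inr j) = N + 1 → ∀ j, 0 < s (Sum.inr j) →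
        0 < t (Sum.inr (j + k • (1 : Fin (m + 1)))) → CycleEquiv K s t := by
      intro k
      induction k with
      | zero =>
        intro s t h hN j hs ht
        exact cycleEquiv_of_common ih h hN hs (by simpa using ht)
      | succ k hk =>
        intro s t h hN j hs ht
        by_cases h0 : 0 < t (Sum.inr j)
        · exact cycleEquiv_of_common ih h hN hs h0
        by_cases h1 : 0 < t (Sum.inr (j + 1))
        · exact cycleEquiv_of_adjacent hm ih h hN hs h1
        obtain ⟨i, rfl⟩ : ∃ i, j = i + 1 := ⟨j - 1, by simp⟩
        by_cases hi : 0 < t (Sum.inr i)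
        · have hx : 0 < s (Sum.inl (i + 1 + 1)) := by
            have := h.2 (i + 1)
            omega
          obtain ⟨s', e, w, h'⟩ := exists_move_left (K := K) hx hs
          exact e.trans (cycleEquiv_of_common ih (w.symm.trans h) (w.1 ▸ hN) h' hi)
        · have hx : 0 < s (Sum.inl (i + 1)) := by
            have := h.2 i
            omega
          obtain ⟨s', e, w, h'⟩ := exists_move_right (K := K) hx hs
          refine e.trans (hk s' t (w.symm.trans h) (w.1 ▸ hN) _ h' ?_)
          rwa [succ_nsmul', ← add_assoc] at ht
    intro s t h hN
    obtain ⟨j, -, hj⟩ : ∃ j ∈ Finset.univ, s (Sum.inr j) ≠ 0 := by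
      by_contra! hcon
      rw [Finset.sum_eq_zero hcon] at hN
      omega
    obtain ⟨i, -, hi⟩ : ∃ j ∈ Finset.univ, t (Sum.inr j) ≠ 0 := by
      by_contra! hcon
      rw [h.1, Finset.sum_eq_zero hcon] at hN
      omega
    obtain ⟨k, -, rfl⟩ := Fin.exists_add_nsmul_one j i
    exact claim k s t h hN j (Nat.pos_of_ne_zero hj) (Nat.pos_of_ne_zero hi)

theorem cycleRees_cycleRelation (j : Fin (m + 1)) (hm : 2 ≤ m) :
    cycleRees K (cycleRelation K j) = 0 := by
  have e : ∀ i k : Fin (m + 1), MvPolynomial.X (Sum.inl i) * MvPolynomial.X (Sum.inr k) =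
      MvPolynomial.monomial (R := K) (Finsupp.single (Sum.inl i) 1 + Finsupp.single (Sum.inr k) 1) 1 := by
    intro i k
    simp [MvPolynomial.X, MvPolynomial.monomial_mul]
  rw [cycleRelation, map_sub, e, e, cycleRees_monomial, cycleRees_monomial, sub_eq_zero]
  have hw : cycleWeight (Finsupp.single (Sum.inl j) 1 + Finsupp.single (Sum.inr j) 1) =
      cycleWeight (Finsupp.single (Sum.inl (j + 1 + 1)) 1 + Finsupp.single (Sum.inr (j + 1)) 1) := by
    have hs := sameWeight_step j
    refine Prod.ext ?_ ?_
    · rw [cycleWeight_fst, cycleWeight_fst, hs.1]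
    · ext v
      obtain ⟨v, rfl⟩ : ∃ i, v = i + 1 := ⟨v - 1, by simp⟩
      have h1 := cycleWeight_snd (Finsupp.single (Sum.inl j) 1 + Finsupp.single (Sum.inr j) 1)
        (by omega) v
      have h2 := cycleWeight_snd (Finsupp.single (Sum.inl (j + 1 + 1)) 1 +
        Finsupp.single (Sum.inr (j + 1)) 1) (by omega) v
      have h3 := hs.2 v
      have h4 := congrArg (fun a : ℕ => (a : ℤ)) hs.1
      simp only [Nat.cast_sum] at h4
      omega
  rw [hw]

theorem ker_cycleRees {r : ℕ} (hm : m = 2 * r) (hr : 1 ≤ r) :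
    RingHom.ker (cycleRees K (m := m)) = cycleRelationIdeal K m := by
  classical
  apply le_antisymm
  · intro p hp
    -- The functional at `(d, e)` takes the coefficient of `x^e t^d` in the image under `cycleRees`.
    refine MvPolynomial.mem_of_binomials_mem _ cycleWeight ?_
      (fun k => (MvPolynomial.lcoeff K k.2).comp
        (((Polynomial.lcoeff (MvPolynomial (Fin (m + 1)) K) k.1).restrictScalars K).comp
          (cycleRees K).toLinearMap)) ?_ p ?_
    · intro s t h
      exact cycleEquiv_of_sameWeight hm _ s t (sameWeight_of_cycleWeight_eq (by omega) h) rfl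
    · intro k s
      simp only [LinearMap.comp_apply, AlgHom.toLinearMap_apply, cycleRees_monomial,
        LinearMap.restrictScalars_apply, Polynomial.lcoeff_apply, Polynomial.coeff_monomial,
        MvPolynomial.lcoeff_apply]
      rw [apply_ite (MvPolynomial.coeff k.2), MvPolynomial.coeff_monomial, MvPolynomial.coeff_zero,
        ← ite_and]
      exact if_congr Prod.ext_iff.symm rfl rfl
    · intro k
      rw [RingHom.mem_ker] at hp
      simp only [LinearMap.comp_apply, AlgHom.toLinearMap_apply]
      rw [hp]
      simp
  · rw [cycleRelationIdeal, Ideal.span_le]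
    rintro _ ⟨j, rfl⟩
    exact cycleRees_cycleRelation j (by omega)

end ToricKernel

/-! ### Syzygies of the linear relations modulo `x` -/

section LinearSyzygies

variable {K : Type u} [Field K] {m : ℕ}

/-- The product `y_{j+2} y_{j+4} ⋯ y_{j+2k}`. -/
noncomputable def alternatingMonomial (R : Type*) [CommSemiring R] (k : ℕ) (j : Fin (m + 1)) :
    MvPolynomial (Fin (m + 1)) R :=
  ∏ s ∈ Finset.range k, MvPolynomial.X (j + (2 * (s + 1)) • (1 : Fin (m + 1)))

theorem alternatingMonomial_succ (R : Type*) [CommSemiring R] (k : ℕ) (j : Fin (m + 1)) :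
    alternatingMonomial R (k + 1) j =
      MvPolynomial.X (j + 1 + 1) * alternatingMonomial R k (j + 1 + 1) := by
  rw [alternatingMonomial, Finset.prod_range_succ', mul_comm]
  have e : ∀ s : ℕ, (2 * (s + 1)) • (1 : Fin (m + 1)) = 1 + 1 + (2 * s) • (1 : Fin (m + 1)) := by
    intro s
    rw [mul_add, add_nsmul, mul_one, two_nsmul, add_comm _ (1 + 1 : Fin (m + 1))]
  congr 1
  · rw [e]; simp [add_assoc]
  · refine Finset.prod_congr rfl fun s _ => ?_
    rw [e (s + 1)]
    simp only [add_assoc]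

theorem alternatingMonomial_succ' (R : Type*) [CommSemiring R] (k : ℕ) (j : Fin (m + 1)) :
    alternatingMonomial R (k + 1) j =
      alternatingMonomial R k j * MvPolynomial.X (j + (2 * (k + 1)) • (1 : Fin (m + 1))) := by
  rw [alternatingMonomial, Finset.prod_range_succ]
  rfl

theorem Fin.two_mul_nsmul_one {r : ℕ} (hm : m = 2 * r) (j : Fin (m + 1)) :
    j + 1 + (2 * r) • (1 : Fin (m + 1)) = j := by
  rw [add_assoc, ← succ_nsmul', ← hm, Fin.nsmul_one_eq_zero_iff.2 dvd_rfl, add_zero]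

/-- Both sides are `y_{j+2} y_{j+4} ⋯ y_{j+2(r+1)}`, because `j + 2(r+1) = j + 1` on the cycle. -/
theorem alternatingMonomial_recurrence (R : Type*) [CommSemiring R] {r : ℕ} (hm : m = 2 * r)
    (j : Fin (m + 1)) :
    alternatingMonomial R r (j + 1 + 1) * MvPolynomial.X (j + 1 + 1) =
      alternatingMonomial R r j * MvPolynomial.X (j + 1) := by
  have e : j + (2 * (r + 1)) • (1 : Fin (m + 1)) = j + 1 := by
    rw [mul_add, add_nsmul, mul_one, two_nsmul]
    refine Eq.trans ?_ (Fin.two_mul_nsmul_one hm (j + 1))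
    abel
  rw [mul_comm, ← alternatingMonomial_succ, alternatingMonomial_succ', e]

theorem alternatingMonomial_ne_zero (k : ℕ) (j : Fin (m + 1)) : alternatingMonomial K k j ≠ 0 :=
  Finset.prod_ne_zero_iff.2 fun _ _ => MvPolynomial.X_ne_zero _

/-- The family `q_j` solves the same recurrence, so `p` and `q` are proportional along steps of 2,
hence along the whole odd cycle; it remains to see that the ratio is a polynomial. -/
theorem exists_eq_mul_alternatingMonomial {r : ℕ} (hm : m = 2 * r)
    (p : Fin (m + 1) → MvPolynomial (Fin (m + 1)) K)
    (hp : ∀ j, p (j + 1 + 1) * MvPolynomial.X (j + 1 + 1) = p j * MvPolynomial.X (j + 1)) :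
    ∃ c, ∀ j, p j = c * alternatingMonomial K r j := by
  set q : Fin (m + 1) → MvPolynomial (Fin (m + 1)) K := alternatingMonomial K r with hq
  have hq0 : ∀ j, q j ≠ 0 := alternatingMonomial_ne_zero r
  have hX : ∀ j : Fin (m + 1), (MvPolynomial.X j : MvPolynomial (Fin (m + 1)) K) ≠ 0 :=
    fun j => MvPolynomial.X_ne_zero j
  have hstep : ∀ j, p (j + 1 + 1) * q j = p j * q (j + 1 + 1) := by
    intro j
    have h1 := hp j
    have h2 : q (j + 1 + 1) * _ = _ := alternatingMonomial_recurrence K hm j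
    refine mul_right_cancel₀ (mul_ne_zero (hX (j + 1 + 1)) (hX (j + 1))) ?_
    linear_combination (q j * MvPolynomial.X (j + 1)) * h1 -
      (p j * MvPolynomial.X (j + 1)) * h2
  have hall : ∀ (k : ℕ) (j : Fin (m + 1)),
      p (j + (2 * k) • (1 : Fin (m + 1))) * q j = p j * q (j + (2 * k) • (1 : Fin (m + 1))) := by
    intro k j
    induction k with
    | zero => simp
    | succ k ih =>
      have e : j + (2 * (k + 1)) • (1 : Fin (m + 1)) = j + (2 * k) • (1 : Fin (m + 1)) + 1 + 1 := by
        rw [mul_add, add_nsmul, mul_one, two_nsmul]; abel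
      rw [e]
      have h1 := hstep (j + (2 * k) • (1 : Fin (m + 1)))
      refine mul_right_cancel₀ (hq0 (j + (2 * k) • (1 : Fin (m + 1)))) ?_
      linear_combination q j * h1 + q (j + (2 * k) • (1 : Fin (m + 1)) + 1 + 1) * ih
  have hcross : ∀ i j, p i * q j = p j * q i := by
    intro i j
    obtain ⟨k, -, rfl⟩ := Fin.exists_add_nsmul_one j i
    -- Modulo `m + 1`, the inverse of 2 is `r + 1`.
    have e : k • (1 : Fin (m + 1)) = (2 * (k * (r + 1))) • (1 : Fin (m + 1)) := by
      have : 2 * (k * (r + 1)) = k + k * (m + 1) := by rw [hm]; ring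
      rw [this, add_nsmul, mul_nsmul', Fin.nsmul_one_eq_zero_iff.2 dvd_rfl, smul_zero, add_zero]
    rw [e]
    exact hall _ j
  -- `q_0` is a product of distinct variables `y_v`. Each divides `p_v q_0 = p_0 q_v` but not `q_v`,
  -- hence divides `p_0`.
  have hdvd : q 0 ∣ p 0 := by
    rw [hq, alternatingMonomial]
    refine Finset.prod_dvd_of_isRelPrime ?_ ?_
    · intro i hi k hk hik
      rw [Finset.coe_range, Set.mem_Iio] at hi hk
      refine MvPolynomial.X_prime.irreducible.isRelPrime_iff_not_dvd.2 fun h => hik ?_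
      have := Fin.nsmul_one_inj (by omega) (by omega) (add_left_cancel (MvPolynomial.X_dvd_X.1 h))
      omega
    · intro s hs
      set v := (0 : Fin (m + 1)) + (2 * (s + 1)) • (1 : Fin (m + 1)) with hv
      have hX : (MvPolynomial.X v : MvPolynomial (Fin (m + 1)) K) ∣ q 0 :=
        Finset.dvd_prod_of_mem (fun s : ℕ => (MvPolynomial.X
          ((0 : Fin (m + 1)) + (2 * (s + 1)) • (1 : Fin (m + 1))) :
            MvPolynomial (Fin (m + 1)) K)) hs
      have h1 : (MvPolynomial.X v : MvPolynomial (Fin (m + 1)) K) ∣ p 0 * q v := by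
        rw [hcross]
        exact hX.mul_left _
      refine (MvPolynomial.X_prime.dvd_or_dvd h1).resolve_right fun h2 => ?_
      rw [hq, alternatingMonomial, MvPolynomial.X_prime.dvd_finsetProd_iff] at h2
      obtain ⟨s, hs, h3⟩ := h2
      rw [Finset.mem_range] at hs
      have := MvPolynomial.X_dvd_X.1 h3
      exact Fin.add_nsmul_one_ne v (k := 2 * (s + 1)) (by omega) (by omega) this.symm
  obtain ⟨c, hc⟩ := hdvd
  refine ⟨c, fun j => mul_right_cancel₀ (hq0 0) ?_⟩
  rw [hcross, hc]
  ring

/-- The specialization `x = 0` of `K[x, y]`. -/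
noncomputable def evalXZero :
    MvPolynomial (Fin (m + 1) ⊕ Fin (m + 1)) K →ₐ[K] MvPolynomial (Fin (m + 1)) K :=
  MvPolynomial.aeval (Sum.elim 0 MvPolynomial.X)

/-- Differentiating by `x_v` and then setting `x = 0` extracts the coefficient of `x_v` in the
`x`-linear part. As `ρ_j` vanishes at `x = 0`, only its derivative contributes when this is applied
to a syzygy. -/
theorem evalXZero_pderiv_cycleRelation (v j : Fin (m + 1)) :
    evalXZero (MvPolynomial.pderiv (Sum.inl v) (cycleRelation K j)) =
      (if j = v then MvPolynomial.X j else 0) -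
        (if j + 1 + 1 = v then MvPolynomial.X (j + 1) else 0) := by
  simp only [cycleRelation, map_sub, Derivation.leibniz, MvPolynomial.pderiv_X, evalXZero, map_add,
    smul_eq_mul, map_mul, MvPolynomial.aeval_X, Sum.elim_inl, Sum.elim_inr, Pi.zero_apply, zero_mul,
    zero_add, Pi.single_apply, Sum.inl.injEq]
  congr 1 <;> split_ifs <;> simp

theorem evalXZero_cycleRelation (j : Fin (m + 1)) : evalXZero (cycleRelation K j) = 0 := by
  simp [cycleRelation, evalXZero]

/-- At `x = 0` the coefficient of `x_{i+2}` in `∑ p_j ρ_j` is `p_{i+2} y_{i+2} - p_i y_{i+1}`, which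
is the recurrence. -/
theorem exists_evalXZero_eq_of_syzygy {r : ℕ} (hm : m = 2 * r)
    (p : Fin (m + 1) → MvPolynomial (Fin (m + 1) ⊕ Fin (m + 1)) K)
    (hp : ∑ j, p j * cycleRelation K j = 0) :
    ∃ c, ∀ j, evalXZero (p j) = c * alternatingMonomial K r j := by
  refine exists_eq_mul_alternatingMonomial hm _ fun i => ?_
  have h := congrArg (fun f => evalXZero (MvPolynomial.pderiv (Sum.inl (i + 1 + 1)) f)) hp
  simp only [map_sum, map_zero, Derivation.leibniz, smul_eq_mul, map_add, map_mul,
    evalXZero_cycleRelation, zero_mul, add_zero, evalXZero_pderiv_cycleRelation,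
    add_left_inj, mul_sub, Finset.sum_sub_distrib, mul_ite, mul_zero, Finset.sum_ite_eq',
    Finset.mem_univ, if_true] at h
  exact sub_eq_zero.1 h

/-- The monomial `y_{j+2} y_{j+4} ⋯ y_{j+2k}` of `K[x, y]`. -/
noncomputable def alternatingY (R : Type*) [CommSemiring R] (k : ℕ) (j : Fin (m + 1)) :
    MvPolynomial (Fin (m + 1) ⊕ Fin (m + 1)) R :=
  MvPolynomial.rename Sum.inr (alternatingMonomial R k j)

theorem evalXZero_rename_inr (f : MvPolynomial (Fin (m + 1)) K) :
    evalXZero (MvPolynomial.rename Sum.inr f) = f := by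
  rw [evalXZero, MvPolynomial.aeval_rename, Sum.elim_comp_inr]
  simp

/-- By the recurrence the sum telescopes around the cycle: its terms are `A_j - A_{j+2}` with `A_j =
x_j y_j q_j`. -/
theorem sum_alternatingY_mul_cycleRelation {r : ℕ} (hm : m = 2 * r) :
    ∑ j : Fin (m + 1), alternatingY K r j * cycleRelation K j = 0 := by
  have key : ∀ j : Fin (m + 1), alternatingY K r j * cycleRelation K j =
      MvPolynomial.X (Sum.inl j) * (alternatingY K r j * MvPolynomial.X (Sum.inr j)) -
      MvPolynomial.X (Sum.inl (j + 1 + 1)) *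
        (alternatingY K r (j + 1 + 1) * MvPolynomial.X (Sum.inr (j + 1 + 1))) := by
    intro j
    have h := congrArg (MvPolynomial.rename (R := K) (Sum.inr : _ → Fin (m + 1) ⊕ Fin (m + 1)))
      (alternatingMonomial_recurrence K hm j)
    simp only [map_mul, MvPolynomial.rename_X] at h
    rw [alternatingY, alternatingY, h, cycleRelation]
    ring
  rw [Finset.sum_congr rfl fun j _ => key j, Finset.sum_sub_distrib, sub_eq_zero]
  symm
  refine Fintype.sum_equiv (Equiv.addRight (1 + 1 : Fin (m + 1))) _ _ fun j => ?_
  simp [add_assoc]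

end LinearSyzygies

/-! ### Linear type -/

section LinearType

variable (K : Type u) [Field K] (m : ℕ)

/-- The ideal generated by the monomials `edgeComplMonomial`. -/
noncomputable def edgeComplIdeal : Ideal (MvPolynomial (Fin (m + 1)) K) :=
  Ideal.span (Set.range (edgeComplMonomial K))

theorem edgeComplMonomial_mem (j : Fin (m + 1)) : edgeComplMonomial K j ∈ edgeComplIdeal K m :=
  Ideal.subset_span ⟨j, rfl⟩

/-- The presentation of the symmetric algebra of the ideal of the monomials
`edgeComplMonomial`. -/
noncomputable def cycleSym : MvPolynomial (Fin (m + 1) ⊕ Fin (m + 1)) K →+*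
    SymmetricAlgebra (MvPolynomial (Fin (m + 1)) K) (edgeComplIdeal K m) :=
  MvPolynomial.eval₂Hom ((algebraMap (MvPolynomial (Fin (m + 1)) K) _).comp MvPolynomial.C)
    (Sum.elim (fun v => algebraMap (MvPolynomial (Fin (m + 1)) K) _ (MvPolynomial.X v))
      (fun j => SymmetricAlgebra.ι _ _ ⟨edgeComplMonomial K j, edgeComplMonomial_mem K m j⟩))

theorem coe_toReesDegreeOne {A : Type*} [CommRing A] (I : Ideal A) (a : I) :
    (toReesDegreeOne I a : Polynomial A) = Polynomial.monomial 1 (a : A) := rfl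

theorem lift_toReesDegreeOne_surjective {A : Type*} [CommRing A] (I : Ideal A) :
    Function.Surjective (SymmetricAlgebra.lift (toReesDegreeOne I)) := by
  rintro ⟨x, hx⟩
  have h : reesAlgebra I ≤
      ((reesAlgebra I).val.comp (SymmetricAlgebra.lift (toReesDegreeOne I))).range := by
    refine (adjoin_monomial_eq_reesAlgebra I).symm.le.trans (Algebra.adjoin_le_iff.2 ?_)
    rintro _ ⟨a, ha, rfl⟩
    refine ⟨SymmetricAlgebra.ι A I ⟨a, ha⟩, ?_⟩
    simp [SymmetricAlgebra.lift_ι_apply, coe_toReesDegreeOne]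
  obtain ⟨s, hs⟩ := h hx
  exact ⟨s, Subtype.ext hs⟩

theorem coe_lift_cycleSym (p : MvPolynomial (Fin (m + 1) ⊕ Fin (m + 1)) K) :
    ((SymmetricAlgebra.lift (toReesDegreeOne (edgeComplIdeal K m)) (cycleSym K m p) :
      reesAlgebra (edgeComplIdeal K m)) : Polynomial (MvPolynomial (Fin (m + 1)) K)) =
    cycleRees K p := by
  have : (((reesAlgebra (edgeComplIdeal K m)).val.comp
      (SymmetricAlgebra.lift (toReesDegreeOne (edgeComplIdeal K m)))).toRingHom.comp
        (cycleSym K m)) = (cycleRees K).toRingHom := by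
    apply MvPolynomial.ringHom_ext
    · intro c
      simp [cycleSym, cycleRees]
    · rintro (v | j)
      · simp [cycleSym, cycleRees]
      · simp [cycleSym, cycleRees, SymmetricAlgebra.lift_ι_apply, coe_toReesDegreeOne]
  exact RingHom.congr_fun this p

theorem cycleSym_surjective : Function.Surjective (cycleSym K m) := by
  have hB : ∀ b, algebraMap (MvPolynomial (Fin (m + 1)) K) _ b ∈ (cycleSym K m).range := by
    intro b
    induction b using MvPolynomial.induction_on with
    | C c => exact ⟨MvPolynomial.C c, by simp [cycleSym]⟩
    | add p q hp hq => rw [map_add]; exact add_mem hp hq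
    | mul_X p v hp => rw [map_mul]; exact mul_mem hp ⟨MvPolynomial.X (Sum.inl v), by simp [cycleSym]⟩
  intro s
  change s ∈ (cycleSym K m).range
  induction s using SymmetricAlgebra.induction with
  | algebraMap b => exact hB b
  | ι a =>
    obtain ⟨a, ha⟩ := a
    refine Submodule.span_induction (p := fun x hx =>
      SymmetricAlgebra.ι (MvPolynomial (Fin (m + 1)) K) (edgeComplIdeal K m) ⟨x, hx⟩ ∈
        (cycleSym K m).range) ?_ ?_ ?_ ?_ ha
    · rintro _ ⟨j, rfl⟩
      exact ⟨MvPolynomial.X (Sum.inr j), by simp [cycleSym]⟩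
    · convert zero_mem (cycleSym K m).range
      exact map_zero (SymmetricAlgebra.ι _ _)
    · intro x y hx hy h1 h2
      convert add_mem h1 h2
      exact map_add (SymmetricAlgebra.ι _ _) (⟨x, hx⟩ : edgeComplIdeal K m) ⟨y, hy⟩
    · intro b x hx h
      convert mul_mem (hB b) h
      rw [← Algebra.smul_def]
      exact map_smul (SymmetricAlgebra.ι _ _) b (⟨x, hx⟩ : edgeComplIdeal K m)
  | mul a b ha hb => exact mul_mem ha hb
  | add a b ha hb => exact add_mem ha hb

theorem X_mul_edgeComplMonomial (hm : 2 ≤ m) (j : Fin (m + 1)) :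
    MvPolynomial.X j * edgeComplMonomial K j =
      MvPolynomial.X (j + 1 + 1) * edgeComplMonomial K (j + 1) := by
  have h := congrArg (fun p => Polynomial.coeff p 1) (cycleRees_cycleRelation (K := K) j hm)
  simpa [cycleRelation, cycleRees, sub_eq_zero] using h

/-- Both algebras are quotients of `S`. The kernel for the Rees algebra is generated by the `ρ_j`,
which vanish in `Sym(I)` because `x_j f_j = x_{j+2} f_{j+1}` holds in `I`. -/
theorem isOfLinearType_edgeComplIdeal {r : ℕ} (hm : m = 2 * r) (hr : 1 ≤ r) :
    IsOfLinearType (edgeComplIdeal K m) := by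
  refine ⟨?_, lift_toReesDegreeOne_surjective _⟩
  rw [injective_iff_map_eq_zero]
  intro s hs
  obtain ⟨p, rfl⟩ := cycleSym_surjective K m s
  have h1 : p ∈ cycleRelationIdeal K m := by
    rw [← ker_cycleRees hm hr, RingHom.mem_ker, ← coe_lift_cycleSym, hs]
    rfl
  have h2 : cycleRelationIdeal K m ≤ RingHom.ker (cycleSym K m) := by
    rw [cycleRelationIdeal, Ideal.span_le]
    rintro _ ⟨j, rfl⟩
    simp only [SetLike.mem_coe, RingHom.mem_ker, cycleRelation, map_sub, map_mul, cycleSym,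
      MvPolynomial.coe_eval₂Hom, MvPolynomial.eval₂_X, Sum.elim_inl, Sum.elim_inr]
    rw [← Algebra.smul_def, ← Algebra.smul_def, ← map_smul, ← map_smul, sub_eq_zero]
    congr 1
    exact Subtype.ext (X_mul_edgeComplMonomial K m (by omega) j)
  exact h2 h1

end LinearType

/-! ### The colon condition passes to the Rees algebra -/

section DSequences

variable {A : Type*} [CommRing A]

/-- The colon condition of a `d`-sequence `b 0, …, b (N - 1)` gives
`(b 0, …, b (i - 1)) ∩ I ^ (k + 1) = (b 0, …, b (i - 1)) I ^ k`. -/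
theorem span_inf_pow_le_of_colon {N : ℕ} {b : ℕ → A} {I : Ideal A}
    (hI : Ideal.span (b '' Set.Iio N) = I)
    (hcolon : ∀ i < N, ∀ z ∈ I, z * b i ∈ Ideal.span (b '' Set.Iio i) →
      z ∈ Ideal.span (b '' Set.Iio i)) (k : ℕ) {i : ℕ} (hi : i ≤ N) :
    Ideal.span (b '' Set.Iio i) ⊓ I ^ (k + 1) ≤ Ideal.span (b '' Set.Iio i) * I ^ k := by
  induction k generalizing i with
  | zero => simp
  | succ k ih =>
    -- For fixed `k` the induction descends from `i = N`, where the ideal is `I` itself.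
    induction hi using Nat.decreasingInduction with
    | self => rw [hI, ← pow_succ' I (k + 1)]; exact inf_le_right
    | of_succ i hi ihi =>
      rintro u ⟨hu, huI⟩
      have hIio : Set.Iio (i + 1) = insert i (Set.Iio i) := by
        ext x; simp only [Set.mem_Iio, Set.mem_insert_iff]; omega
      have hsucc : Ideal.span (b '' Set.Iio (i + 1)) =
          Ideal.span (b '' Set.Iio i) ⊔ Ideal.span {b i} := by
        rw [← Ideal.span_union, hIio, Set.image_insert_eq, Set.union_singleton]
      -- Let `J = (b_0, …, b_{i-1})`. The case `i + 1` gives `u = v + s b_i` with `v ∈ J I^(k+1)`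
      -- and `s ∈ I^(k+1)`. The colon condition puts `s` in `J`, and the case `k` then puts it in `J
      -- I^k`.
      have h1 := ihi ⟨by rw [hsucc]; exact Ideal.mem_sup_left hu, huI⟩
      rw [hsucc, Ideal.sup_mul] at h1
      obtain ⟨v, hv, w, hw, rfl⟩ := Submodule.mem_sup.1 h1
      obtain ⟨s, hs, rfl⟩ := Ideal.mem_span_singleton_mul.1 hw
      refine Ideal.add_mem _ hv ?_
      have hs1 : s * b i ∈ Ideal.span (b '' Set.Iio i) := by
        have hv' : v ∈ Ideal.span (b '' Set.Iio i) := Ideal.mul_le_left hv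
        rwa [SetLike.mem_coe, Ideal.add_mem_iff_right _ hv', mul_comm] at hu
      have hs2 := hcolon i hi s (Ideal.pow_le_self (Nat.succ_ne_zero k) hs) hs1
      have hs3 := ih hi.le ⟨hs2, hs⟩
      have hb : b i ∈ I := by rw [← hI]; exact Ideal.subset_span ⟨i, hi, rfl⟩
      have := Ideal.mul_mem_mul hs3 hb
      rwa [mul_assoc, ← pow_succ, mul_comm s] at this

/-- For `p` in the ideal and `q ∈ I^k`, one has `p q t^(k+1) = (p t)(q t^k)`. -/
theorem exists_mem_span_coe_eq_monomial {I : Ideal A} {b : ℕ → A} (hb : ∀ i, b i ∈ I) (i k : ℕ)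
    {w : A} (hw : w ∈ Ideal.span (b '' Set.Iio i) * I ^ k) :
    ∃ x ∈ Ideal.span ((fun i => toReesDegreeOne I ⟨b i, hb i⟩) '' Set.Iio i),
      (x : Polynomial A) = Polynomial.monomial (k + 1) w := by
  have hone : ∀ p ∈ Ideal.span (b '' Set.Iio i),
      ∃ x ∈ Ideal.span ((fun i => toReesDegreeOne I ⟨b i, hb i⟩) '' Set.Iio i),
        (x : Polynomial A) = Polynomial.monomial 1 p := by
    intro p hp
    induction hp using Submodule.span_induction with
    | mem x hx =>
      obtain ⟨l, hl, rfl⟩ := hx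
      exact ⟨_, Ideal.subset_span ⟨l, hl, rfl⟩, rfl⟩
    | zero => exact ⟨0, zero_mem _, by simp⟩
    | add x y _ _ hx hy =>
      obtain ⟨x', hx', ex⟩ := hx
      obtain ⟨y', hy', ey⟩ := hy
      exact ⟨x' + y', add_mem hx' hy', by simp [ex, ey]⟩
    | smul c x _ hx =>
      obtain ⟨x', hx', ex⟩ := hx
      exact ⟨algebraMap A _ c * x', Ideal.mul_mem_left _ _ hx', by
        simp [ex, Polynomial.C_mul_monomial]⟩
  induction hw using Submodule.mul_induction_on' with
  | mem_mul_mem p hp q hq =>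
    obtain ⟨x, hx, ex⟩ := hone p hp
    refine ⟨x * ⟨Polynomial.monomial k q, reesAlgebra.monomial_mem.2 hq⟩,
      Ideal.mul_mem_right _ _ hx, ?_⟩
    simp [ex, Polynomial.monomial_mul_monomial, add_comm]
  | add x _ y _ hx hy =>
    obtain ⟨x', hx', ex⟩ := hx
    obtain ⟨y', hy', ey⟩ := hy
    exact ⟨x' + y', add_mem hx' hy', by simp [ex, ey]⟩

/-- Work in each `t`-degree `d ≥ 1`, with `J = (b_0, …, b_{i-1})`. The coefficient lies in `I`, so
the colon condition puts it in `J`; lying also in `I^d`, it belongs to `J I^(d-1)`. The vanishing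
constant term disposes of degree 0, where the coefficient need not lie in `I`. -/
theorem reesAlgebra_mem_span_of_mul_mem {N : ℕ} {b : ℕ → A} {I : Ideal A} (hb : ∀ i, b i ∈ I)
    (hI : Ideal.span (b '' Set.Iio N) = I)
    (hcolon : ∀ i < N, ∀ z ∈ I, z * b i ∈ Ideal.span (b '' Set.Iio i) →
      z ∈ Ideal.span (b '' Set.Iio i)) {i : ℕ} (hi : i < N) (u : reesAlgebra I)
    (hu : (u : Polynomial A).coeff 0 = 0)
    (h : u * toReesDegreeOne I ⟨b i, hb i⟩ ∈
      Ideal.span ((fun i => toReesDegreeOne I ⟨b i, hb i⟩) '' Set.Iio i)) :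
    u ∈ Ideal.span ((fun i => toReesDegreeOne I ⟨b i, hb i⟩) '' Set.Iio i) := by
  classical
  have hle : Ideal.span ((fun i => toReesDegreeOne I ⟨b i, hb i⟩) '' Set.Iio i) ≤
      (Ideal.map Polynomial.C (Ideal.span (b '' Set.Iio i))).comap (reesAlgebra I).val := by
    rw [Ideal.span_le]
    rintro _ ⟨l, hl, rfl⟩
    rw [SetLike.mem_coe, Ideal.mem_comap, Ideal.mem_map_C_iff]
    intro d
    rw [Subalgebra.coe_val, coe_toReesDegreeOne, Polynomial.coeff_monomial]
    split_ifs
    · exact Ideal.subset_span ⟨l, hl, rfl⟩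
    · exact zero_mem _
  have hmem : ∀ d, (u : Polynomial A).coeff d * b i ∈ Ideal.span (b '' Set.Iio i) := by
    intro d
    have h1 := hle h
    rw [Ideal.mem_comap, Ideal.mem_map_C_iff] at h1
    have h2 := h1 (d + 1)
    rwa [Subalgebra.coe_val, Subalgebra.coe_mul, coe_toReesDegreeOne,
      Polynomial.coeff_mul_monomial] at h2
  have hx : ∀ d, ∃ x ∈ Ideal.span ((fun i => toReesDegreeOne I ⟨b i, hb i⟩) '' Set.Iio i),
      (x : Polynomial A) = Polynomial.monomial d ((u : Polynomial A).coeff d) := by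
    intro d
    rcases d with _ | d
    · exact ⟨0, zero_mem _, by simp [hu]⟩
    · have hd : (u : Polynomial A).coeff (d + 1) ∈ I ^ (d + 1) := u.2 (d + 1)
      have h1 := hcolon i hi _ (Ideal.pow_le_self (Nat.succ_ne_zero d) hd) (hmem (d + 1))
      exact exists_mem_span_coe_eq_monomial hb i d
        (span_inf_pow_le_of_colon hI hcolon d hi.le ⟨h1, hd⟩)
  choose x hx hx' using hx
  have : u = ∑ d ∈ (u : Polynomial A).support, x d := by
    apply Subtype.ext
    rw [AddSubmonoidClass.coe_finsetSum]
    simp only [hx']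
    exact Polynomial.as_sum_support _
  rw [this]
  exact Ideal.sum_mem _ fun d _ => hx d

end DSequences

/-! ### Koszul cycles with coefficients in `P` -/

section Koszul

variable {R : Type*} [CommRing R]

theorem exists_sum_range_eq_of_mem_span {θ : ℕ → R} {i : ℕ} {u : R}
    (h : u ∈ Ideal.span (θ '' Set.Iio i)) :
    ∃ v : ℕ → R, u = ∑ k ∈ Finset.range i, v k * θ k := by
  rw [← Finset.coe_range] at h
  obtain ⟨v, hv⟩ := (Submodule.mem_span_image_finset_iff_exists_fun R).1 h
  refine ⟨fun k => if hk : k ∈ Finset.range i then v ⟨k, hk⟩ else 0, ?_⟩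
  rw [← hv, ← Finset.sum_coe_sort (Finset.range i)]
  exact Finset.sum_congr rfl fun k _ => by simp

variable {θ : ℕ → R} {P : Ideal R} {N : ℕ}

/-- The Koszul complex of a sequence satisfying the colon condition on `P` has no first homology
with coefficients in `P`. -/
theorem koszul_one_exact (hθ : ∀ i < N, θ i ∈ P)
    (hcolon : ∀ i < N, ∀ u ∈ P, u * θ i ∈ Ideal.span (θ '' Set.Iio i) →
      u ∈ Ideal.span (θ '' Set.Iio i)) {i : ℕ} (hi : i ≤ N) (u : ℕ → R)
    (hu : ∀ k < i, u k ∈ P) (hsum : ∑ k ∈ Finset.range i, u k * θ k = 0) :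
    ∃ w : ℕ → ℕ → R, ∀ l < i, u l = ∑ j ∈ Finset.range i, (w j l - w l j) * θ j := by
  induction i generalizing u with
  | zero => exact ⟨0, by simp⟩
  | succ i ih =>
    rw [Finset.sum_range_succ] at hsum
    have hmem : u i * θ i ∈ Ideal.span (θ '' Set.Iio i) := by
      rw [eq_neg_of_add_eq_zero_right hsum]
      refine neg_mem (Ideal.sum_mem _ fun k hk => Ideal.mul_mem_left _ _ ?_)
      exact Ideal.subset_span ⟨k, Finset.mem_range.1 hk, rfl⟩
    -- The colon condition writes the last coefficient as `u_i = ∑ v_k θ_k`. Then `u_k + v_k θ_i` is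
    -- a shorter cycle, still in `P` since `θ_i ∈ P`.
    obtain ⟨v, hv⟩ := exists_sum_range_eq_of_mem_span
      (hcolon i (by omega) (u i) (hu i (by omega)) hmem)
    obtain ⟨w, hw⟩ := ih (by omega) (fun k => u k + v k * θ i)
      (fun k hk => add_mem (hu k (by omega)) (P.mul_mem_left _ (hθ i (by omega)))) (by
        rw [hv] at hsum
        rw [← hsum, Finset.sum_mul, ← Finset.sum_add_distrib]
        exact Finset.sum_congr rfl fun k _ => by ring)
    -- A second chain is a matrix `w` read through `w - wᵀ`, so no division by 2 occurs; the new row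
    -- records `v`.
    refine ⟨fun j l => if j = i then -v l else if l = i then 0 else w j l, fun l hl => ?_⟩
    have hne : ∀ j ∈ Finset.range i, j ≠ i := fun j hj => (Finset.mem_range.1 hj).ne
    rw [Finset.sum_range_succ]
    rcases Nat.lt_succ_iff_lt_or_eq.1 hl with hl | rfl
    · have e : ∑ j ∈ Finset.range i, ((if j = i then -v l else if l = i then 0 else w j l) -
          (if l = i then -v j else if j = i then 0 else w l j)) * θ j =
          ∑ j ∈ Finset.range i, (w j l - w l j) * θ j :=
        Finset.sum_congr rfl fun j hj => by simp [hne j hj, hl.ne]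
      rw [e, ← hw l hl]
      simp [hl.ne]
    · rw [sub_self, zero_mul, add_zero, hv]
      exact Finset.sum_congr rfl fun j hj => by simp [hne j hj]

/-- Second Koszul cycles with coefficients in `P` lift along a surjection. -/
theorem koszul_two_cycle_lift {S : Type*} [CommRing S] {φ : S →+* R} (hφ : Function.Surjective φ)
    {T : ℕ → S} (hT : ∀ i, φ (T i) = θ i) (hθ : ∀ i < N, θ i ∈ P)
    (hcolon : ∀ i < N, ∀ u ∈ P, u * θ i ∈ Ideal.span (θ '' Set.Iio i) →
      u ∈ Ideal.span (θ '' Set.Iio i)) {i : ℕ} (hi : i ≤ N) (u : ℕ → ℕ → R)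
    (hu : ∀ j < i, ∀ l < i, u j l ∈ P)
    (hsum : ∀ l < i, ∑ j ∈ Finset.range i, (u j l - u l j) * θ j = 0) :
    ∃ U : ℕ → ℕ → S, (∀ j < i, ∀ l < i, φ (U j l) = u j l) ∧
      ∀ l < i, ∑ j ∈ Finset.range i, (U j l - U l j) * T j = 0 := by
  induction i generalizing u with
  | zero => exact ⟨0, by simp, by simp⟩
  | succ i ih =>
    have h1 := hsum i (by omega)
    rw [Finset.sum_range_succ, sub_self, zero_mul, add_zero] at h1
    -- The coefficients involving `e_i` form a first Koszul cycle, hence the boundary of some `w`.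
    -- Adding `w θ_i` to the others gives a shorter second cycle, to which induction applies.
    obtain ⟨w, hw⟩ := koszul_one_exact hθ hcolon (i := i) (by omega) (fun l => u i l - u l i)
      (fun k hk => sub_mem (hu _ (by omega) _ (by omega)) (hu _ (by omega) _ (by omega))) (by
        rw [← neg_eq_zero, ← Finset.sum_neg_distrib, ← h1]
        exact Finset.sum_congr rfl fun k _ => by ring)
    obtain ⟨U', hU', hUs⟩ := ih (by omega) (fun j l => u j l + w j l * θ i)
      (fun j hj l hl => add_mem (hu _ (by omega) _ (by omega))
        (P.mul_mem_left _ (hθ i (by omega)))) (by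
        intro l hl
        have h2 := hsum l (by omega)
        rw [Finset.sum_range_succ, hw l hl, Finset.sum_mul, ← Finset.sum_add_distrib] at h2
        rw [← h2]
        exact Finset.sum_congr rfl fun k _ => by ring)
    choose g hg using hφ
    let W : ℕ → ℕ → S := fun j l => g (w j l)
    -- `Y_l` lifts `u i l - u l i` as an explicit boundary, and `U` is chosen so that `U i l - U l i
    -- = Y_l` exactly. In row `l < i` the correction `-W T_i` cancels `Y_l T_i`; in row `i`, `∑ Y_j
    -- T_j = 0` by antisymmetry.
    let Y : ℕ → S := fun l => ∑ j ∈ Finset.range i, (W j l - W l j) * T j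
    let U : ℕ → ℕ → S := fun j l =>
      if j = i then (if l = i then g (u i i) else g (u l i) + Y l)
      else if l = i then g (u j i) else U' j l - W j l * T i
    have hii : U i i = g (u i i) := by simp [U]
    have hil : ∀ l < i, U i l = g (u l i) + Y l := fun l hl => by simp [U, hl.ne]
    have hli : ∀ l < i, U l i = g (u l i) := fun l hl => by simp [U, hl.ne]
    have hjl : ∀ j < i, ∀ l < i, U j l = U' j l - W j l * T i := fun j hj l hl => by
      simp [U, hl.ne, hj.ne]
    refine ⟨U, fun j hj l hl => ?_, fun l hl => ?_⟩
    · rcases Nat.lt_succ_iff_lt_or_eq.1 hj with hj | rfl <;>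
        rcases Nat.lt_succ_iff_lt_or_eq.1 hl with hl | rfl
      · rw [hjl j hj l hl, map_sub, map_mul, hU' j hj l hl, hg, hT, add_sub_cancel_right]
      · rw [hli j hj, hg]
      · rw [hil l hl, map_add, hg, map_sum]
        simp only [map_mul, map_sub, W, hg, hT]
        rw [← hw l hl, add_sub_cancel]
      · rw [hii, hg]
    · rw [Finset.sum_range_succ]
      rcases Nat.lt_succ_iff_lt_or_eq.1 hl with hl | rfl
      · have e : ∑ j ∈ Finset.range i, (U j l - U l j) * T j =
            ∑ j ∈ Finset.range i, (U' j l - U' l j) * T j - Y l * T i := by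
          rw [Finset.sum_mul, ← Finset.sum_sub_distrib]
          refine Finset.sum_congr rfl fun j hj => ?_
          rw [hjl j (Finset.mem_range.1 hj) l hl, hjl l hl j (Finset.mem_range.1 hj)]
          ring
        rw [e, hUs l hl, hil l hl, hli l hl]
        ring
      · have e : ∑ j ∈ Finset.range l, (U j l - U l j) * T j =
            ∑ j ∈ Finset.range l, ∑ k ∈ Finset.range l, (W j k - W k j) * T k * T j := by
          refine Finset.sum_congr rfl fun j hj => ?_
          rw [hli j (Finset.mem_range.1 hj), hil j (Finset.mem_range.1 hj), sub_add_cancel_left,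
            neg_mul, Finset.sum_mul, ← Finset.sum_neg_distrib]
          exact Finset.sum_congr rfl fun k _ => by ring
        rw [e, sub_self, zero_mul, add_zero]
        simp only [sub_mul, Finset.sum_sub_distrib]
        rw [sub_eq_zero, Finset.sum_comm]
        exact Finset.sum_congr rfl fun j _ => Finset.sum_congr rfl fun k _ => by ring

/-- The map on second Koszul chains induced by a matrix `c`. -/
def koszulPush {ι κ : Type*} [Fintype ι] (c : ι → κ → R) (u : ι → ι → R) (k l : κ) : R :=
  ∑ i, ∑ j, u i j * c i k * c j l

/-- Expressing `T` through `y` by a matrix induces a map of Koszul complexes; this is its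
compatibility with the boundary. -/
theorem sum_koszulPush {ι κ : Type*} [Fintype ι] [Fintype κ] (c : ι → κ → R) (u : ι → ι → R)
    {y : κ → R} {T : ι → R} (hT : ∀ i, T i = ∑ k, c i k * y k) (l : κ) :
    ∑ k, (koszulPush c u k l - koszulPush c u l k) * y k =
      ∑ j, c j l * ∑ i, (u i j - u j i) * T i := by
  have h1 : ∀ k, koszulPush c u k l = ∑ j, ∑ i, u i j * c i k * c j l :=
    fun k => Finset.sum_comm
  have h2 : ∀ k, koszulPush c u l k = ∑ j, ∑ i, u j i * c j l * c i k := fun k => rfl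
  calc ∑ k, (koszulPush c u k l - koszulPush c u l k) * y k
      = ∑ k, ∑ j, ∑ i, c j l * ((u i j - u j i) * (c i k * y k)) := by
        refine Finset.sum_congr rfl fun k _ => ?_
        rw [h1, h2, ← Finset.sum_sub_distrib, Finset.sum_mul]
        refine Finset.sum_congr rfl fun j _ => ?_
        rw [← Finset.sum_sub_distrib, Finset.sum_mul]
        exact Finset.sum_congr rfl fun i _ => by ring
    _ = ∑ j, c j l * ∑ i, (u i j - u j i) * T i := by
        rw [Finset.sum_comm]
        refine Finset.sum_congr rfl fun j _ => ?_
        rw [Finset.sum_comm, Finset.mul_sum]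
        refine Finset.sum_congr rfl fun i _ => ?_
        rw [hT, Finset.mul_sum, Finset.mul_sum]

end Koszul

/-! ### A Koszul cycle that does not lift -/

section NotDSequence

variable {K : Type u} [Field K] {m : ℕ}

/-- The second Koszul chain `∑ x_l y_{l+4} ⋯ y_{l+2k+2} e_l ∧ e_{l+2}`. -/
noncomputable def cycleChain (K : Type u) [Field K] {m : ℕ} (k : ℕ) (i l : Fin (m + 1)) :
    MvPolynomial (Fin (m + 1) ⊕ Fin (m + 1)) K :=
  if l = i + 1 + 1 then MvPolynomial.X (Sum.inl i) * alternatingY K k (i + 1 + 1) else 0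

/-- Only `j = i` and `j = i + 4` contribute. The recurrence with `y_{i+2}` cancelled gives the two
terms a common factor, leaving a multiple of `ρ_i`, which vanishes in the Rees algebra. -/
theorem sum_cycleChain {r k : ℕ} (hm : m = 2 * r) (hk : r = k + 1) (i : Fin (m + 1)) :
    ∑ j, (cycleChain K k j (i + 1 + 1) - cycleChain K k (i + 1 + 1) j) *
      MvPolynomial.X (Sum.inr j) = alternatingY K k (i + 1 + 1) * cycleRelation K i := by
  have h1 : ∑ j, cycleChain K k j (i + 1 + 1) * MvPolynomial.X (Sum.inr j) =
      MvPolynomial.X (Sum.inl i) * alternatingY K k (i + 1 + 1) * MvPolynomial.X (Sum.inr i) := by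
    simp only [cycleChain, add_left_inj, ite_mul, zero_mul, Finset.sum_ite_eq, Finset.mem_univ,
      if_true]
  have h2 : ∑ j, cycleChain K k (i + 1 + 1) j * MvPolynomial.X (Sum.inr j) =
      MvPolynomial.X (Sum.inl (i + 1 + 1)) * alternatingY K k (i + 1 + 1 + 1 + 1) *
        MvPolynomial.X (Sum.inr (i + 1 + 1 + 1 + 1)) := by
    simp only [cycleChain, ite_mul, zero_mul, Finset.sum_ite_eq', Finset.mem_univ,
      if_true]
  have h3 : alternatingY K k (i + 1 + 1 + 1 + 1) * MvPolynomial.X (Sum.inr (i + 1 + 1 + 1 + 1)) =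
      alternatingY K k (i + 1 + 1) * MvPolynomial.X (Sum.inr (i + 1)) := by
    have h := alternatingMonomial_recurrence K hm i
    rw [hk, alternatingMonomial_succ, alternatingMonomial_succ] at h
    have h' : alternatingMonomial K k (i + 1 + 1 + 1 + 1) * MvPolynomial.X (i + 1 + 1 + 1 + 1) =
        alternatingMonomial K k (i + 1 + 1) * MvPolynomial.X (i + 1) := by
      refine mul_right_cancel₀ (MvPolynomial.X_ne_zero (i + 1 + 1)) ?_
      linear_combination h
    have := congrArg (MvPolynomial.rename (R := K) (Sum.inr : _ → Fin (m + 1) ⊕ Fin (m + 1))) h'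
    simpa only [map_mul, MvPolynomial.rename_X, alternatingY] using this
  simp only [sub_mul, Finset.sum_sub_distrib]
  rw [h1, h2, mul_assoc, mul_assoc, h3, cycleRelation]
  ring

/-- The chain `cycleChain` is a Koszul cycle modulo the relations of the Rees algebra, but it does
not lift to a Koszul cycle over `K[x, y]`. -/
theorem cycleChain_not_liftable {r k : ℕ} (hm : m = 2 * r) (hk : r = k + 1)
    (U : Fin (m + 1) → Fin (m + 1) → MvPolynomial (Fin (m + 1) ⊕ Fin (m + 1)) K)
    (hU : ∀ i l, cycleRees K (U i l) = cycleRees K (cycleChain K k i l))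
    (hcycle : ∀ l, ∑ i, (U i l - U l i) * MvPolynomial.X (Sum.inr i) = 0) : False := by
  have hdiff : ∀ i l, ∃ g : Fin (m + 1) → MvPolynomial (Fin (m + 1) ⊕ Fin (m + 1)) K,
      ∑ j, g j * cycleRelation K j = cycleChain K k i l - U i l := by
    intro i l
    have : cycleChain K k i l - U i l ∈ cycleRelationIdeal K m := by
      rw [← ker_cycleRees hm (by omega), RingHom.mem_ker, map_sub, hU, sub_self]
    exact Ideal.mem_span_range_iff_exists_fun.1 this
  choose g hg using hdiff
  -- Subtracting the zero boundary of `U` from the boundary of the chain writes a multiple of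
  -- `ρ_{l-2}` through all `ρ_j`: one syzygy for each `l`.
  have hsyz : ∀ l, ∑ j, ((if j + 1 + 1 = l then alternatingY K k l else 0) -
      ∑ i, (g i l j - g l i j) * MvPolynomial.X (Sum.inr i)) * cycleRelation K j = 0 := by
    intro l
    obtain ⟨t, rfl⟩ : ∃ t, l = t + 1 + 1 := ⟨l - 1 - 1, by simp⟩
    have h1 := sum_cycleChain (K := K) hm hk t
    have h2 := hcycle (t + 1 + 1)
    simp only [sub_mul _ _ (cycleRelation K _), Finset.sum_sub_distrib, ite_mul, zero_mul,
      add_left_inj, Finset.sum_ite_eq', Finset.mem_univ, if_true]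
    rw [sub_eq_zero, ← h1, ← sub_zero (∑ j, _), ← h2, ← Finset.sum_sub_distrib]
    have h3 : ∀ i, (cycleChain K k i (t + 1 + 1) - cycleChain K k (t + 1 + 1) i) *
        MvPolynomial.X (Sum.inr i) - (U i (t + 1 + 1) - U (t + 1 + 1) i) *
          MvPolynomial.X (Sum.inr i) =
        ∑ j, (g i (t + 1 + 1) j - g (t + 1 + 1) i j) * MvPolynomial.X (Sum.inr i) *
          cycleRelation K j := by
      intro i
      have : ∀ j, (g i (t + 1 + 1) j - g (t + 1 + 1) i j) * MvPolynomial.X (Sum.inr i) *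
          cycleRelation K j = (g i (t + 1 + 1) j * cycleRelation K j -
            g (t + 1 + 1) i j * cycleRelation K j) * MvPolynomial.X (Sum.inr i) :=
        fun j => by ring
      simp only [this]
      rw [← Finset.sum_mul, Finset.sum_sub_distrib, hg, hg]
      ring
    simp only [h3]
    rw [Finset.sum_comm]
    exact Finset.sum_congr rfl fun j _ => (Finset.sum_mul _ _ _).symm
  choose c hc using fun l => exists_evalXZero_eq_of_syzygy hm _ (hsyz l)
  have hX : ∀ i : Fin (m + 1), evalXZero (MvPolynomial.X (Sum.inr i)) =
      (MvPolynomial.X i : MvPolynomial (Fin (m + 1)) K) := fun i => by simp [evalXZero]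
  -- Take the coefficient of `ρ_0` in each syzygy, multiply by `y_l` and sum over `l`: the skew part
  -- cancels, and only `l = 2` contributes, giving `q_0`.
  have hsum : ∑ l, evalXZero ((if (0 : Fin (m + 1)) + 1 + 1 = l then alternatingY K k l else 0) -
      ∑ i, (g i l 0 - g l i 0) * MvPolynomial.X (Sum.inr i)) * MvPolynomial.X l =
      alternatingMonomial K r 0 := by
    have hskew : ∑ l, ∑ i, (evalXZero (g i l 0) - evalXZero (g l i 0)) * MvPolynomial.X i *
        MvPolynomial.X l = 0 := by
      simp only [sub_mul, Finset.sum_sub_distrib]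
      rw [sub_eq_zero, Finset.sum_comm]
      exact Finset.sum_congr rfl fun j _ => Finset.sum_congr rfl fun k _ => by ring
    simp only [map_sub, map_sum, map_mul, hX, sub_mul, Finset.sum_sub_distrib, Finset.sum_mul,
      apply_ite evalXZero, map_zero, ite_mul, zero_mul, Finset.sum_ite_eq, Finset.mem_univ,
      if_true] at hskew ⊢
    rw [hskew, sub_zero, hk, alternatingMonomial_succ, alternatingY, evalXZero_rename_inr]
    ring
  simp only [hc] at hsum
  -- The same coefficients are `c_l q_0` by the description of syzygies, so `q_0` cancels.
  have hone : ∑ l, c l * MvPolynomial.X l = 1 := by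
    refine mul_right_cancel₀ (alternatingMonomial_ne_zero (K := K) r 0) ?_
    rw [one_mul, Finset.sum_mul]
    refine Eq.trans ?_ hsum
    exact Finset.sum_congr rfl fun l _ => by ring
  have := congrArg MvPolynomial.constantCoeff hone
  simp at this

/-- The monomials `f_j` are appended to the given sequence. The colon condition survives, as the
earlier terms already generate `I`, and `z` becomes a chain on members of the sequence. Its lift is
carried back by a matrix expressing all terms through the `f_j`. -/
theorem not_exists_dSequence {r : ℕ} (hm : m = 2 * r) (hr : 2 ≤ r) {M : ℕ}
    (a : Fin M → MvPolynomial (Fin (m + 1)) K) (ha : IsDSequence a)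
    (hspan : Ideal.span (Set.range a) = edgeComplIdeal K m) : False := by
  classical
  set I := edgeComplIdeal K m with hIdef
  obtain ⟨k, hk⟩ : ∃ k, r = k + 1 := ⟨r - 1, by omega⟩
  let b' : Fin (M + (m + 1)) → MvPolynomial (Fin (m + 1)) K :=
    Fin.append a (edgeComplMonomial K)
  let b : ℕ → MvPolynomial (Fin (m + 1)) K := fun i =>
    if h : i < M + (m + 1) then b' ⟨i, h⟩ else 0
  have hb'I : ∀ i, b' i ∈ I := by
    intro i
    refine Fin.addCases (fun i => ?_) (fun i => ?_) i
    · simp only [b', Fin.append_left]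
      rw [← hspan]
      exact Ideal.subset_span ⟨i, rfl⟩
    · simp only [b', Fin.append_right]
      exact edgeComplMonomial_mem K m i
  have hbI : ∀ i, b i ∈ I := by
    intro i
    simp only [b]
    split_ifs
    · exact hb'I _
    · exact zero_mem _
  have hbfin : ∀ i : Fin (M + (m + 1)), b i = b' i := fun i => by simp [b]
  have hba : ∀ (l : ℕ) (hl : l < M), b l = a ⟨l, hl⟩ := by
    intro l hl
    have := hbfin (Fin.castAdd (m + 1) ⟨l, hl⟩)
    simp only [b', Fin.append_left] at this
    exact this
  have himg : ∀ i : Fin M, b '' Set.Iio (i : ℕ) = a '' Set.Iio i := by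
    intro i
    ext x
    constructor
    · rintro ⟨l, hl, rfl⟩
      rw [Set.mem_Iio] at hl
      exact ⟨⟨l, by omega⟩, hl, (hba l _).symm⟩
    · rintro ⟨l, hl, rfl⟩
      exact ⟨l, hl, hba l l.2⟩
  have hIM : ∀ i, M ≤ i → Ideal.span (b '' Set.Iio i) = I := by
    intro i hi
    apply le_antisymm
    · rw [Ideal.span_le]
      rintro _ ⟨l, -, rfl⟩
      exact hbI l
    · rw [← hspan, Ideal.span_le]
      rintro _ ⟨l, rfl⟩
      exact Ideal.subset_span ⟨l, l.2.trans_le hi, hba l l.2⟩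
  have hcolon : ∀ i < M + (m + 1), ∀ z ∈ I, z * b i ∈ Ideal.span (b '' Set.Iio i) →
      z ∈ Ideal.span (b '' Set.Iio i) := by
    intro i hi z hz h
    by_cases hiM : i < M
    · have hbi := hba i hiM
      have h1 := ha ⟨i, hiM⟩
      rw [← himg ⟨i, hiM⟩, hspan, ← hbi] at h1
      have : z ∈ (Ideal.span (b '' Set.Iio i) : Set (MvPolynomial (Fin (m + 1)) K)) := by
        rw [← h1]
        exact ⟨h, hz⟩
      exact this
    · rw [hIM i (by omega)]
      exact hz
  let φ : MvPolynomial (Fin (m + 1) ⊕ Fin (m + 1)) K →+* reesAlgebra I :=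
    (SymmetricAlgebra.lift (toReesDegreeOne I)).toRingHom.comp (cycleSym K m)
  have hφ : Function.Surjective φ :=
    (lift_toReesDegreeOne_surjective I).comp (cycleSym_surjective K m)
  have hφc : ∀ p, ((φ p : reesAlgebra I) : Polynomial _) = cycleRees K p := coe_lift_cycleSym K m
  let θ : ℕ → reesAlgebra I := fun i => toReesDegreeOne I ⟨b i, hbI i⟩
  have hca : ∀ i, ∃ c : Fin (m + 1) → MvPolynomial (Fin (m + 1)) K,
      ∑ j, c j * edgeComplMonomial K j = a i := by
    intro i
    have : a i ∈ I := by rw [← hspan]; exact Ideal.subset_span ⟨i, rfl⟩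
    exact Ideal.mem_span_range_iff_exists_fun.1 this
  choose ca hca using hca
  let c : Fin (M + (m + 1)) → Fin (m + 1) → MvPolynomial (Fin (m + 1)) K :=
    Fin.append ca (fun j l => if j = l then 1 else 0)
  have hc : ∀ i, ∑ j, c i j * edgeComplMonomial K j = b' i := by
    intro i
    refine Fin.addCases (fun i => ?_) (fun i => ?_) i
    · simp only [c, b', Fin.append_left, hca]
    · simp [c, b', Fin.append_right]
  let cS : Fin (M + (m + 1)) → Fin (m + 1) → MvPolynomial (Fin (m + 1) ⊕ Fin (m + 1)) K :=
    fun i j => MvPolynomial.rename Sum.inl (c i j)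
  let T' : Fin (M + (m + 1)) → MvPolynomial (Fin (m + 1) ⊕ Fin (m + 1)) K :=
    fun i => ∑ j, cS i j * MvPolynomial.X (Sum.inr j)
  have hrename : ∀ p : MvPolynomial (Fin (m + 1)) K,
      cycleRees K (MvPolynomial.rename Sum.inl p) = Polynomial.C p := by
    intro p
    rw [cycleRees, MvPolynomial.aeval_rename, Sum.elim_comp_inl]
    induction p using MvPolynomial.induction_on with
    | C x => simp
    | add p q hp hq => rw [map_add, hp, hq, map_add]
    | mul_X p v hp => rw [map_mul, hp, map_mul, MvPolynomial.aeval_X]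
  have hT' : ∀ i, cycleRees K (T' i) = Polynomial.monomial 1 (b' i) := by
    intro i
    simp only [T', map_sum, map_mul, cS, hrename]
    rw [← hc i, map_sum]
    refine Finset.sum_congr rfl fun j _ => ?_
    rw [← Polynomial.C_mul_monomial]
    simp [cycleRees]
  let T : ℕ → MvPolynomial (Fin (m + 1) ⊕ Fin (m + 1)) K := fun i =>
    if h : i < M + (m + 1) then T' ⟨i, h⟩ else 0
  have hTθ : ∀ i, φ (T i) = θ i := by
    intro i
    apply Subtype.ext
    rw [hφc, coe_toReesDegreeOne]
    simp only [T, b]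
    split_ifs
    · exact hT' _
    · simp
  let P : Ideal (reesAlgebra I) :=
    RingHom.ker ((Polynomial.constantCoeff).comp (reesAlgebra I).val.toRingHom)
  have hP : ∀ u : reesAlgebra I, u ∈ P ↔
      (u : Polynomial (MvPolynomial (Fin (m + 1)) K)).coeff 0 = 0 := fun u => Iff.rfl
  have hθP : ∀ i < M + (m + 1), θ i ∈ P := by
    intro i _
    rw [hP, coe_toReesDegreeOne, Polynomial.coeff_monomial_of_ne _ (by norm_num)]
  have hFR : ∀ i < M + (m + 1), ∀ u ∈ P, u * θ i ∈ Ideal.span (θ '' Set.Iio i) →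
      u ∈ Ideal.span (θ '' Set.Iio i) := fun i hi u hu h =>
    reesAlgebra_mem_span_of_mul_mem hbI (hIM _ (by omega)) hcolon hi u ((hP u).1 hu) h
  let E : Fin (m + 1) → Fin (M + (m + 1)) → reesAlgebra I :=
    fun j i => if i = Fin.natAdd M j then 1 else 0
  let z : Fin (m + 1) → Fin (m + 1) → reesAlgebra I := fun i l => φ (cycleChain K k i l)
  have hzP : ∀ i l, z i l ∈ P := by
    intro i l
    rw [hP, hφc, cycleChain]
    split_ifs
    -- Since `r ≥ 2`, at least one factor `y` is present, so the image has positive `t`-degree.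
    · obtain ⟨k, rfl⟩ : ∃ k', k = k' + 1 := ⟨k - 1, by omega⟩
      rw [alternatingY, alternatingMonomial_succ, map_mul (MvPolynomial.rename Sum.inr),
        MvPolynomial.rename_X, map_mul, map_mul,
        Polynomial.mul_coeff_zero, Polynomial.mul_coeff_zero]
      simp [cycleRees]
    · simp
  have hφrel : ∀ j, φ (cycleRelation K j) = 0 := fun j => Subtype.ext <| by
    rw [hφc, cycleRees_cycleRelation j (by omega)]; rfl
  have hzcycle : ∀ l, ∑ i, (z i l - z l i) * φ (MvPolynomial.X (Sum.inr i)) = 0 := by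
    intro l
    obtain ⟨t, rfl⟩ : ∃ t, l = t + 1 + 1 := ⟨l - 1 - 1, by simp⟩
    have := congrArg φ (sum_cycleChain (K := K) hm hk t)
    simpa only [map_sum, map_mul, map_sub, hφrel, mul_zero] using this
  let u' : Fin (M + (m + 1)) → Fin (M + (m + 1)) → reesAlgebra I := koszulPush E z
  have hE : ∀ j, φ (MvPolynomial.X (Sum.inr j)) = ∑ i, E j i * θ i := by
    intro j
    simp only [E, ite_mul, one_mul, zero_mul, Finset.sum_ite_eq', Finset.mem_univ, if_true]
    apply Subtype.ext
    rw [hφc, coe_toReesDegreeOne]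
    change _ = Polynomial.monomial 1 (b _)
    rw [hbfin]
    simp [cycleRees, b']
  let u : ℕ → ℕ → reesAlgebra I := fun i j =>
    if h : i < M + (m + 1) ∧ j < M + (m + 1) then u' ⟨i, h.1⟩ ⟨j, h.2⟩ else 0
  have hufin : ∀ i j : Fin (M + (m + 1)), u i j = u' i j := fun i j => by simp [u]
  obtain ⟨U, hU, hUcycle⟩ := koszul_two_cycle_lift hφ hTθ hθP hFR le_rfl u
    (by
      intro i hi j hj
      have := hufin ⟨i, hi⟩ ⟨j, hj⟩
      simp only at this
      rw [this]
      exact Ideal.sum_mem _ fun _ _ => Ideal.sum_mem _ fun _ _ =>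
        Ideal.mul_mem_right _ _ (Ideal.mul_mem_right _ _ (hzP _ _)))
    (by
      intro l hl
      have h1 := sum_koszulPush E z (y := fun i : Fin (M + (m + 1)) => θ i) hE ⟨l, hl⟩
      simp only [hzcycle, mul_zero, Finset.sum_const_zero] at h1
      rw [← h1, Finset.sum_range]
      refine Finset.sum_congr rfl fun i _ => ?_
      have h2 := hufin i ⟨l, hl⟩
      have h3 := hufin ⟨l, hl⟩ i
      simp only at h2 h3
      rw [h2, h3])
  refine cycleChain_not_liftable hm hk (koszulPush cS fun i j => U i j) ?_ ?_
  · intro i l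
    rw [← hφc, ← hφc]
    congr 1
    change _ = z i l
    -- The matrix `c` is the identity on the appended block, which `E` selects; pushing `z` out and
    -- back therefore returns `z`.
    have hEc : ∀ j l, ∑ i, E j i * φ (cS i l) = if j = l then 1 else 0 := by
      intro j l
      simp only [E, ite_mul, one_mul, zero_mul, Finset.sum_ite_eq', Finset.mem_univ, if_true, cS, c,
        Fin.append_right]
      split_ifs <;> simp
    have hφU : φ (koszulPush cS (fun i j => U i j) i l) =
        koszulPush (fun i j => φ (cS i j)) u' i l := by
      simp only [koszulPush, map_sum, map_mul]
      refine Finset.sum_congr rfl fun p _ => Finset.sum_congr rfl fun q _ => ?_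
      rw [hU p p.2 q q.2, hufin]
    have hassoc : koszulPush (fun i j => φ (cS i j)) u' i l =
        koszulPush (fun j l => ∑ i, E j i * φ (cS i l)) z i l := by
      have h1 : ∀ p q, u' p q * φ (cS p i) * φ (cS q l) =
          ∑ s, ∑ t, z s t * (E s p * φ (cS p i)) * (E t q * φ (cS q l)) := by
        intro p q
        simp only [u', koszulPush, Finset.sum_mul]
        exact Finset.sum_congr rfl fun s _ => Finset.sum_congr rfl fun t _ => by ring
      have h2 : ∀ s t, z s t * (∑ p, E s p * φ (cS p i)) * (∑ q, E t q * φ (cS q l)) =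
          ∑ p, ∑ q, z s t * (E s p * φ (cS p i)) * (E t q * φ (cS q l)) := by
        intro s t
        rw [Finset.mul_sum Finset.univ (fun p => E s p * φ (cS p i)), Finset.sum_mul]
        exact Finset.sum_congr rfl fun p _ => Finset.mul_sum _ _ _
      unfold koszulPush
      simp only [h1, h2]
      calc _ = ∑ p, ∑ s, ∑ q, ∑ t, z s t * (E s p * φ (cS p i)) * (E t q * φ (cS q l)) :=
            Finset.sum_congr rfl fun p _ => Finset.sum_comm
        _ = ∑ s, ∑ p, ∑ q, ∑ t, z s t * (E s p * φ (cS p i)) * (E t q * φ (cS q l)) :=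
            Finset.sum_comm
        _ = ∑ s, ∑ p, ∑ t, ∑ q, z s t * (E s p * φ (cS p i)) * (E t q * φ (cS q l)) :=
            Finset.sum_congr rfl fun s _ => Finset.sum_congr rfl fun p _ => Finset.sum_comm
        _ = _ := Finset.sum_congr rfl fun s _ => Finset.sum_comm
    rw [hφU, hassoc]
    simp only [hEc, koszulPush, mul_ite, mul_one, mul_zero, Finset.sum_ite_eq', Finset.mem_univ,
      if_true]
  · intro l
    rw [sum_koszulPush cS (fun i j => U i j) (T := T') (fun i => rfl) l]
    refine Finset.sum_eq_zero fun j _ => ?_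
    have h1 := hUcycle j j.2
    rw [Finset.sum_range] at h1
    have h2 : ∀ i : Fin (M + (m + 1)), T i = T' i := fun i => by simp [T]
    simp only [h2] at h1
    rw [h1, mul_zero]

end NotDSequence

/-! ### Bihomogeneous components in free modules -/

section BigradedModules

variable {K : Type u} [Field K] {σ : Type} {τ : Type u} {ι ι' : Type*}

/-- The element `v` of a free module on a bigraded basis is homogeneous of bidegree `e`. -/
def IsBihomogeneous (deg : ι → ℕ × ℕ) (v : ι →₀ MvPolynomial (σ ⊕ τ) K) (e : ℕ × ℕ) : Prop :=
  ∀ c, ∀ s ∈ (v c).support, bidegree s + deg c = e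

open Classical in
/-- The component of bidegree `e` of an element of a free module on a bigraded basis. -/
noncomputable def bicomponent (deg : ι → ℕ × ℕ) (e : ℕ × ℕ) (v : ι →₀ MvPolynomial (σ ⊕ τ) K) :
    ι →₀ MvPolynomial (σ ⊕ τ) K :=
  Finsupp.onFinset v.support (fun c => ∑ s ∈ (v c).support with bidegree s + deg c = e,
    MvPolynomial.monomial s ((v c).coeff s)) (fun c hc => by
      rw [Finsupp.mem_support_iff]
      intro h
      simp [h] at hc)

open Classical in
theorem coeff_bicomponent (deg : ι → ℕ × ℕ) (e : ℕ × ℕ) (v : ι →₀ MvPolynomial (σ ⊕ τ) K) (c : ι)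
    (t : (σ ⊕ τ) →₀ ℕ) : (bicomponent deg e v c).coeff t =
      if bidegree t + deg c = e then (v c).coeff t else 0 := by
  rw [bicomponent, Finsupp.onFinset_apply, MvPolynomial.coeff_sum]
  simp only [MvPolynomial.coeff_monomial, Finset.sum_ite_eq', Finset.mem_filter,
    MvPolynomial.mem_support_iff]
  by_cases h : (v c).coeff t = 0 <;> simp [h]

theorem isBihomogeneous_bicomponent (deg : ι → ℕ × ℕ) (e : ℕ × ℕ)
    (v : ι →₀ MvPolynomial (σ ⊕ τ) K) : IsBihomogeneous deg (bicomponent deg e v) e := by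
  classical
  intro c s hs
  rw [MvPolynomial.mem_support_iff, coeff_bicomponent] at hs
  by_contra h
  exact hs (if_neg h)

theorem bicomponent_add (deg : ι → ℕ × ℕ) (e : ℕ × ℕ) (v w : ι →₀ MvPolynomial (σ ⊕ τ) K) :
    bicomponent deg e (v + w) = bicomponent deg e v + bicomponent deg e w := by
  classical
  ext c t
  rw [Finsupp.add_apply, MvPolynomial.coeff_add, coeff_bicomponent, coeff_bicomponent,
    coeff_bicomponent, Finsupp.add_apply, MvPolynomial.coeff_add]
  split_ifs <;> simp

theorem bicomponent_zero (deg : ι → ℕ × ℕ) (e : ℕ × ℕ) :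
    bicomponent deg e (0 : ι →₀ MvPolynomial (σ ⊕ τ) K) = 0 := by
  classical
  ext c t
  simp [coeff_bicomponent]

theorem exists_eq_sum_bicomponent (deg : ι → ℕ × ℕ) (v : ι →₀ MvPolynomial (σ ⊕ τ) K) :
    ∃ E : Finset (ℕ × ℕ), v = ∑ e ∈ E, bicomponent deg e v := by
  classical
  refine ⟨v.support.biUnion fun c => (v c).support.image fun s => bidegree s + deg c, ?_⟩
  ext c t
  rw [Finsupp.finsetSum_apply, MvPolynomial.coeff_sum]
  simp only [coeff_bicomponent, Finset.sum_ite_eq]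
  split_ifs with h
  · rfl
  · by_contra ht
    apply h
    refine Finset.mem_biUnion.2 ⟨c, ?_, Finset.mem_image.2 ⟨t, MvPolynomial.mem_support_iff.2 ht, rfl⟩⟩
    rw [Finsupp.mem_support_iff]
    intro h0
    simp [h0] at ht

variable {deg : ι → ℕ × ℕ} {deg' : ι' → ℕ × ℕ}

theorem map_bicomponent
    (d : (ι' →₀ MvPolynomial (σ ⊕ τ) K) →ₗ[MvPolynomial (σ ⊕ τ) K] (ι →₀ MvPolynomial (σ ⊕ τ) K))
    (hd : ∀ b, IsBihomogeneous deg (d (Finsupp.single b 1)) (deg' b)) (e : ℕ × ℕ)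
    (v : ι' →₀ MvPolynomial (σ ⊕ τ) K) :
    bicomponent deg e (d v) = d (bicomponent deg' e v) := by
  classical
  induction v using Finsupp.induction_linear with
  | zero => rw [map_zero, bicomponent_zero, bicomponent_zero, map_zero]
  | add v w hv hw => rw [map_add, bicomponent_add, hv, hw, bicomponent_add, map_add]
  | single b p =>
    induction p using MvPolynomial.induction_on' with
    | add p q hp hq =>
      rw [Finsupp.single_add, map_add, bicomponent_add, hp, hq, bicomponent_add, map_add]
    | monomial s a =>
      have h1 : bicomponent deg' e (Finsupp.single b (MvPolynomial.monomial s a)) =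
          if bidegree s + deg' b = e then Finsupp.single b (MvPolynomial.monomial s a) else 0 := by
        ext c t
        rw [coeff_bicomponent]
        by_cases hc : b = c
        · subst hc
          by_cases hs : s = t
          · subst hs
            split_ifs <;> simp
          · split_ifs <;> simp [MvPolynomial.coeff_monomial, hs]
        · split_ifs <;> simp [Finsupp.single_eq_of_ne' hc]
      have h2 : d (Finsupp.single b (MvPolynomial.monomial s a)) =
          MvPolynomial.monomial s a • d (Finsupp.single b 1) := by
        rw [← map_smul, Finsupp.smul_single, smul_eq_mul, mul_one]
      have h3 : ∀ c t, (d (Finsupp.single b (MvPolynomial.monomial s a)) c).coeff t ≠ 0 →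
          bidegree t + deg c = bidegree s + deg' b := by
        intro c t ht
        rw [h2, Finsupp.smul_apply, smul_eq_mul, MvPolynomial.coeff_monomial_mul'] at ht
        split_ifs at ht with hst
        · have := hd b c (t - s) (MvPolynomial.mem_support_iff.2 (right_ne_zero_of_mul ht))
          rw [← this, ← add_assoc, ← map_add, add_tsub_cancel_of_le hst]
        · exact absurd rfl ht
      rw [h1]
      ext c t
      rw [coeff_bicomponent]
      by_cases ht : (d (Finsupp.single b (MvPolynomial.monomial s a)) c).coeff t = 0
      · split_ifs <;> simp [ht]
      · rw [h3 c t ht]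
        split_ifs <;> simp

/-- The kernel of a bihomogeneous map is generated by bihomogeneous elements. -/
theorem ker_le_of_bihomogeneous
    (d : (ι' →₀ MvPolynomial (σ ⊕ τ) K) →ₗ[MvPolynomial (σ ⊕ τ) K] (ι →₀ MvPolynomial (σ ⊕ τ) K))
    (hd : ∀ b, IsBihomogeneous deg (d (Finsupp.single b 1)) (deg' b))
    (N : Submodule (MvPolynomial (σ ⊕ τ) K) (ι' →₀ MvPolynomial (σ ⊕ τ) K))
    (hN : ∀ v e, d v = 0 → IsBihomogeneous deg' v e → v ∈ N) : LinearMap.ker d ≤ N := by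
  classical
  intro v hv
  obtain ⟨E, hE⟩ := exists_eq_sum_bicomponent deg' v
  rw [hE]
  refine Submodule.sum_mem _ fun e _ => hN _ e ?_ (isBihomogeneous_bicomponent _ _ _)
  rw [← map_bicomponent d hd, LinearMap.mem_ker.1 hv, bicomponent_zero]

end BigradedModules

/-! ### Bigraded free resolutions and a criterion for nonzero `Tor` -/

section Resolutions

variable (K : Type u) [Field K] (σ : Type) (τ : Type u)

/-- A homogeneous map between free modules on bigraded bases. -/
structure BigradedFreeMap where
  ι₀ : Type u
  ι₁ : Type u
  deg₀ : ι₀ → ℕ × ℕ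
  deg₁ : ι₁ → ℕ × ℕ
  d : (ι₁ →₀ MvPolynomial (σ ⊕ τ) K) →ₗ[MvPolynomial (σ ⊕ τ) K] (ι₀ →₀ MvPolynomial (σ ⊕ τ) K)
  homogeneous : ∀ b, IsBihomogeneous deg₀ (d (Finsupp.single b 1)) (deg₁ b)

variable {K σ τ}

namespace BigradedFreeMap

/-- The map onto the kernel from the free module on the homogeneous elements of the kernel. -/
noncomputable def step (f : BigradedFreeMap K σ τ) : BigradedFreeMap K σ τ where
  ι₀ := f.ι₁
  -- The bidegree is part of the basis element, because the zero vector is bihomogeneous of every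
  -- bidegree.
  ι₁ := {p : (f.ι₁ →₀ MvPolynomial (σ ⊕ τ) K) × (ℕ × ℕ) //
    f.d p.1 = 0 ∧ IsBihomogeneous f.deg₁ p.1 p.2}
  deg₀ := f.deg₁
  deg₁ := fun p => p.1.2
  d := Finsupp.linearCombination _ fun p => p.1.1
  homogeneous := fun b => by
    rw [Finsupp.linearCombination_single, one_smul]
    exact b.2.2

theorem exact_linearCombination (f : BigradedFreeMap K σ τ) :
    Function.Exact (Finsupp.linearCombination (MvPolynomial (σ ⊕ τ) K)
      fun p : {p : (f.ι₁ →₀ MvPolynomial (σ ⊕ τ) K) × (ℕ × ℕ) //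
        f.d p.1 = 0 ∧ IsBihomogeneous f.deg₁ p.1 p.2} => p.1.1) f.d := by
  rw [LinearMap.exact_iff]
  apply le_antisymm
  · refine ker_le_of_bihomogeneous f.d f.homogeneous _ fun v e hv he => ?_
    exact ⟨Finsupp.single ⟨(v, e), hv, he⟩ 1, by simp⟩
  · rw [LinearMap.range_le_ker_iff]
    refine Finsupp.lhom_ext' fun b => LinearMap.ext_ring ?_
    simp only [LinearMap.comp_apply, Finsupp.lsingle_apply,
      Finsupp.linearCombination_single, one_smul, LinearMap.zero_apply]
    exact b.2.1

theorem exact_step (f : BigradedFreeMap K σ τ) : Function.Exact f.step.d f.d :=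
  f.exact_linearCombination

/-- The sequence of homogeneous maps obtained by iterating `step`. -/
noncomputable def seq (f : BigradedFreeMap K σ τ) : ℕ → BigradedFreeMap K σ τ
  | 0 => f
  | i + 1 => (seq f i).step

end BigradedFreeMap

variable {M : Type u} [AddCommGroup M] [Module (MvPolynomial (σ ⊕ τ) K) M]
  {𝓜 : ℕ × ℕ → AddSubgroup M}

/-- Any bigraded presentation with its first syzygies extends to a bigraded free resolution. -/
noncomputable def BigradedFreeResolution.ofSyzygies (f : BigradedFreeMap K σ τ) (ι : Type u)
    (deg : ι → ℕ × ℕ)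
    (d : (f.ι₀ →₀ MvPolynomial (σ ⊕ τ) K) →ₗ[MvPolynomial (σ ⊕ τ) K]
      (ι →₀ MvPolynomial (σ ⊕ τ) K))
    (aug : (ι →₀ MvPolynomial (σ ⊕ τ) K) →ₗ[MvPolynomial (σ ⊕ τ) K] M)
    (hd : ∀ b, IsBihomogeneous deg (d (Finsupp.single b 1)) (f.deg₀ b))
    (haug : ∀ b, aug (Finsupp.single b 1) ∈ 𝓜 (deg b))
    (hsurj : Function.Surjective aug) (h0 : Function.Exact d aug) (h1 : Function.Exact f.d d) :
    BigradedFreeResolution K σ τ 𝓜 where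
  ι := fun i => match i with
    | 0 => ι
    | i + 1 => (f.seq i).ι₀
  deg := fun i => match i with
    | 0 => deg
    | i + 1 => (f.seq i).deg₀
  d := fun i => match i with
    | 0 => d
    | i + 1 => (f.seq i).d
  aug := aug
  d_homogeneous := fun i => match i with
    | 0 => hd
    | i + 1 => (f.seq i).homogeneous
  aug_homogeneous := haug
  aug_surjective := hsurj
  exact_zero := h0
  exact_succ := fun i => match i with
    | 0 => h1
    | i + 1 => (f.seq i).exact_step

/-- A basis element whose bidegree is not a multiple of the bidegrees of the others, and whose
boundary is nonzero without constant terms, has a nonzero class in `Tor`. -/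
theorem BigradedFreeResolution.torNeZero (F : BigradedFreeResolution K σ τ 𝓜) (i : ℕ)
    (b₀ : F.ι (i + 1))
    (hconst : ∀ c, MvPolynomial.constantCoeff (F.d i (Finsupp.single b₀ 1) c) = 0)
    (hne : F.d i (Finsupp.single b₀ 1) ≠ 0)
    (hdeg : ∀ c, c ≠ b₀ → ∀ s : (σ ⊕ τ) →₀ ℕ, bidegree s + F.deg (i + 1) c ≠ F.deg (i + 1) b₀) :
    TorNeZero K σ τ 𝓜 (i + 1) (F.deg (i + 1) b₀) := by
  classical
  refine ⟨F, fun hle => ?_⟩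
  have hmem : Finsupp.single b₀ (1 : K) ∈ F.bigradedCycles (i + 1) (F.deg (i + 1) b₀) := by
    refine ⟨?_, Finsupp.single_mem_supported K _ rfl⟩
    change Finsupp.single b₀ (1 : K) ∈ LinearMap.ker (F.dK i)
    rw [LinearMap.mem_ker, dK, Finsupp.linearCombination_single, one_smul]
    ext c
    simpa using hconst c
  obtain ⟨y, hy⟩ := hle hmem
  have h1 := DFunLike.congr_fun hy b₀
  rw [Finsupp.single_eq_same, dK, Finsupp.linearCombination_apply, Finsupp.sum,
    Finsupp.finsetSum_apply] at h1
  obtain ⟨b, -, hb⟩ := Finset.exists_ne_zero_of_sum_ne_zero (h1.trans_ne one_ne_zero)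
  rw [Finsupp.smul_apply, smul_eq_mul, Finsupp.mapRange_apply] at hb
  have hcc := right_ne_zero_of_mul hb
  -- If `b₀` were a boundary, some `d b` would have a nonzero constant term at `b₀`, so `b` and `b₀`
  -- share a bidegree. No other basis element can then occur in `d b`, and `d² = 0` forces a nonzero
  -- multiple of `d b₀` to vanish.
  have h0 : (0 : (σ ⊕ τ) →₀ ℕ) ∈ (F.d (i + 1) (Finsupp.single b 1) b₀).support :=
    MvPolynomial.mem_support_iff.2 hcc
  have hbdeg := F.d_homogeneous (i + 1) b b₀ 0 h0
  rw [map_zero, zero_add] at hbdeg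
  have hd : F.d (i + 1) (Finsupp.single b 1) =
      F.d (i + 1) (Finsupp.single b 1) b₀ • Finsupp.single b₀ 1 := by
    ext1 c
    rw [Finsupp.smul_apply, smul_eq_mul]
    by_cases hc : c = b₀
    · subst hc
      rw [Finsupp.single_eq_same, mul_one]
    · rw [Finsupp.single_eq_of_ne hc, mul_zero, ← MvPolynomial.support_eq_empty,
        Finset.eq_empty_iff_forall_notMem]
      intro s hs
      exact hdeg c hc s ((F.d_homogeneous (i + 1) b c s hs).trans hbdeg.symm)
  have hzero := (F.exact_succ i).apply_apply_eq_zero (Finsupp.single b 1)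
  rw [hd, map_smul] at hzero
  obtain ⟨c, hc⟩ := DFunLike.ne_iff.1 hne
  have := DFunLike.congr_fun hzero c
  rw [Finsupp.smul_apply, smul_eq_mul] at this
  refine mul_ne_zero ?_ hc this
  intro h
  rw [h] at hcc
  exact hcc (map_zero _)

end Resolutions

/-! ### The syzygy of bidegree `(1, r+1)` and the `y`-regularity -/

section YRegularity

variable {K : Type u} [Field K] {σ : Type} {τ : Type u}

/-- The weights of the bigrading. -/
theorem bidegree_eq_weight (s : (σ ⊕ τ) →₀ ℕ) : bidegree s = Finsupp.weight
    (Sum.elim (fun _ : σ => ((1, 0) : ℕ × ℕ)) (fun _ : τ => ((0, 1) : ℕ × ℕ))) s := rfl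

theorem eq_zero_of_bidegree_fst_eq_zero {s : (σ ⊕ τ) →₀ ℕ} (h : (bidegree s).1 = 0) (v : σ) :
    s (Sum.inl v) = 0 := by
  rw [bidegree_eq_weight, Finsupp.weight_apply, Finsupp.sum, Prod.fst_sum,
    Finset.sum_eq_zero_iff] at h
  by_contra hv
  have := h (Sum.inl v) (Finsupp.mem_support_iff.2 hv)
  simp at this
  exact hv this

theorem aeval_eq_self_of_bidegree_fst_eq_zero (p : MvPolynomial (σ ⊕ τ) K)
    (hp : ∀ s ∈ p.support, (bidegree s).1 = 0) :
    MvPolynomial.aeval (Sum.elim 0 fun t => MvPolynomial.X (Sum.inr t) :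
      σ ⊕ τ → MvPolynomial (σ ⊕ τ) K) p = p := by
  conv_lhs => rw [p.as_sum, map_sum]
  conv_rhs => rw [p.as_sum]
  refine Finset.sum_congr rfl fun s hs => ?_
  rw [MvPolynomial.aeval_monomial, MvPolynomial.monomial_eq, MvPolynomial.algebraMap_eq]
  congr 1
  refine Finsupp.prod_congr fun i hi => ?_
  rcases i with v | t
  · exact absurd (eq_zero_of_bidegree_fst_eq_zero (hp s hs) v) (Finsupp.mem_support_iff.1 hi)
  · rfl

variable (K) (m : ℕ)

/-- The generators of the ideal, indexed by the vertices of the cycle. -/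
noncomputable def cycleGens : Set (MvPolynomial (Fin (m + 3)) K) :=
  Set.range (edgeComplMonomial K : Fin (m + 3) → _)

noncomputable def cycleGensEquiv : Fin (m + 3) ≃ cycleGens K m :=
  Equiv.ofInjective _ (edgeComplMonomial_injective K m)

noncomputable instance : Fintype (cycleGens K m) := Fintype.ofEquiv _ (cycleGensEquiv K m)

/-- The relabelling of the `y`-variables by the generators of the ideal. -/
noncomputable def cycleRename : MvPolynomial (Fin (m + 3) ⊕ Fin (m + 3)) K ≃ₐ[K]
    MvPolynomial (Fin (m + 3) ⊕ cycleGens K m) K :=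
  MvPolynomial.renameEquiv K (Equiv.sumCongr (Equiv.refl _) (cycleGensEquiv K m))

theorem cycleRename_X_inl (v : Fin (m + 3)) :
    cycleRename K m (MvPolynomial.X (Sum.inl v)) = MvPolynomial.X (Sum.inl v) := by
  simp [cycleRename]

theorem cycleRename_X_inr (j : Fin (m + 3)) :
    cycleRename K m (MvPolynomial.X (Sum.inr j)) =
      MvPolynomial.X (Sum.inr (cycleGensEquiv K m j)) := by
  simp [cycleRename]

theorem cycleRename_evalXZero (p : MvPolynomial (Fin (m + 3) ⊕ cycleGens K m) K) :
    cycleRename K m (MvPolynomial.rename Sum.inr (evalXZero ((cycleRename K m).symm p))) =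
      MvPolynomial.aeval (Sum.elim 0 fun t => MvPolynomial.X (Sum.inr t) :
        Fin (m + 3) ⊕ cycleGens K m → MvPolynomial (Fin (m + 3) ⊕ cycleGens K m) K) p := by
  obtain ⟨q, rfl⟩ := (cycleRename K m).surjective p
  rw [AlgEquiv.symm_apply_apply]
  have : ((cycleRename K m).toAlgHom.comp (MvPolynomial.rename Sum.inr)).comp evalXZero =
      (MvPolynomial.aeval (Sum.elim 0 fun t => MvPolynomial.X (Sum.inr t) :
        Fin (m + 3) ⊕ cycleGens K m → MvPolynomial (Fin (m + 3) ⊕ cycleGens K m) K)).comp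
          (cycleRename K m).toAlgHom := by
    apply MvPolynomial.algHom_ext
    rintro (v | j)
    · simp [evalXZero, cycleRename]
    · simp [evalXZero, cycleRename]
  exact DFunLike.congr_fun this q

theorem reesPresentation_cycleRename (p : MvPolynomial (Fin (m + 3) ⊕ Fin (m + 3)) K) :
    (reesAlgebra (Ideal.span (cycleGens K m))).val
      (reesPresentation (cycleGens K m) (cycleRename K m p)) = cycleRees K p := by
  have : (((reesAlgebra (Ideal.span (cycleGens K m))).val.toRingHom.comp
      (reesPresentation (cycleGens K m)).toRingHom).comp (cycleRename K m).toRingHom) =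
      (cycleRees K).toRingHom := by
    apply MvPolynomial.ringHom_ext
    · intro c
      change (reesAlgebra (Ideal.span (cycleGens K m))).val (reesPresentation (cycleGens K m)
        (cycleRename K m (algebraMap K _ c))) = cycleRees K (algebraMap K _ c)
      rw [AlgEquiv.commutes, AlgHom.commutes, AlgHom.commutes]
      rfl
    · rintro (v | j)
      · change (reesAlgebra (Ideal.span (cycleGens K m))).val (reesPresentation (cycleGens K m)
          (cycleRename K m (MvPolynomial.X (Sum.inl v)))) = cycleRees K (MvPolynomial.X (Sum.inl v))
        rw [cycleRename_X_inl, reesPresentation, MvPolynomial.aeval_X, cycleRees,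
          MvPolynomial.aeval_X]
        rfl
      · change (reesAlgebra (Ideal.span (cycleGens K m))).val (reesPresentation (cycleGens K m)
          (cycleRename K m (MvPolynomial.X (Sum.inr j)))) = cycleRees K (MvPolynomial.X (Sum.inr j))
        rw [cycleRename_X_inr, reesPresentation, MvPolynomial.aeval_X, cycleRees,
          MvPolynomial.aeval_X]
        rfl
  exact RingHom.congr_fun this p

theorem cycleRename_cycleRelation_bihomogeneous (j : Fin (m + 3)) :
    (cycleRename K m (cycleRelation K j)).IsWeightedHomogeneous
      (Sum.elim (fun _ => ((1, 0) : ℕ × ℕ)) (fun _ => ((0, 1) : ℕ × ℕ))) (1, 1) := by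
  rw [cycleRelation, map_sub, map_mul, map_mul, cycleRename_X_inl, cycleRename_X_inl,
    cycleRename_X_inr, cycleRename_X_inr]
  have hX : ∀ (v : Fin (m + 3)) (g : cycleGens K m),
      (MvPolynomial.X (Sum.inl v) * MvPolynomial.X (Sum.inr g) :
        MvPolynomial (Fin (m + 3) ⊕ cycleGens K m) K).IsWeightedHomogeneous
        (Sum.elim (fun _ => ((1, 0) : ℕ × ℕ)) (fun _ => ((0, 1) : ℕ × ℕ))) (1, 1) :=
    fun v g => (MvPolynomial.isWeightedHomogeneous_X K _ (Sum.inl v)).mul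
      (MvPolynomial.isWeightedHomogeneous_X K _ (Sum.inr g))
  exact (MvPolynomial.weightedHomogeneousSubmodule K _ _).sub_mem (hX _ _) (hX _ _)

theorem cycleRename_alternatingY_bihomogeneous (k : ℕ) (j : Fin (m + 3)) :
    (cycleRename K m (alternatingY K k j)).IsWeightedHomogeneous
      (Sum.elim (fun _ => ((1, 0) : ℕ × ℕ)) (fun _ => ((0, 1) : ℕ × ℕ))) (0, k) := by
  rw [alternatingY, alternatingMonomial, map_prod, map_prod]
  have : ((0, k) : ℕ × ℕ) = ∑ _s ∈ Finset.range k, (0, 1) := by simp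
  rw [this]
  refine MvPolynomial.IsWeightedHomogeneous.prod _ _ _ fun s _ => ?_
  rw [MvPolynomial.rename_X, cycleRename_X_inr]
  exact MvPolynomial.isWeightedHomogeneous_X K _ _

/-- The presentation of the linear relations of the Rees algebra. -/
noncomputable def cycleRelationMap :
    (cycleGens K m →₀ MvPolynomial (Fin (m + 3) ⊕ cycleGens K m) K)
      →ₗ[MvPolynomial (Fin (m + 3) ⊕ cycleGens K m) K]
    (PUnit.{u + 1} →₀ MvPolynomial (Fin (m + 3) ⊕ cycleGens K m) K) :=
  Finsupp.linearCombination _ fun g => Finsupp.single PUnit.unit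
    (cycleRename K m (cycleRelation K ((cycleGensEquiv K m).symm g)))

theorem cycleRelationMap_apply
    (v : cycleGens K m →₀ MvPolynomial (Fin (m + 3) ⊕ cycleGens K m) K) :
    cycleRelationMap K m v = Finsupp.single PUnit.unit
      (∑ j, v (cycleGensEquiv K m j) * cycleRename K m (cycleRelation K j)) := by
  rw [cycleRelationMap, Finsupp.linearCombination_apply, Finsupp.sum_fintype _ _ (by simp),
    ← (cycleGensEquiv K m).sum_comp]
  simp [Finsupp.single_finsetSum]

/-- The syzygy of the linear relations of the Rees algebra of degree `(1, k + 1)`. -/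
noncomputable def cycleSyzygy (k : ℕ) :
    cycleGens K m →₀ MvPolynomial (Fin (m + 3) ⊕ cycleGens K m) K :=
  Finsupp.equivFunOnFinite.symm fun g =>
    cycleRename K m (alternatingY K k ((cycleGensEquiv K m).symm g))

theorem cycleSyzygy_apply (k : ℕ) (g : cycleGens K m) :
    cycleSyzygy K m k g = cycleRename K m (alternatingY K k ((cycleGensEquiv K m).symm g)) := rfl

theorem cycleRelationMap_cycleSyzygy {r : ℕ} (hm : m + 2 = 2 * r) :
    cycleRelationMap K m (cycleSyzygy K m r) = 0 := by
  rw [cycleRelationMap_apply]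
  simp only [cycleSyzygy_apply, Equiv.symm_apply_apply, ← map_mul, ← map_sum]
  rw [sum_alternatingY_mul_cycleRelation hm, map_zero, Finsupp.single_zero]

theorem cycleRelationMap_bihomogeneous (g : cycleGens K m) :
    IsBihomogeneous (fun _ => (0, 0)) (cycleRelationMap K m (Finsupp.single g 1)) (1, 1) := by
  intro c s hs
  rw [cycleRelationMap, Finsupp.linearCombination_single, one_smul] at hs
  obtain rfl : c = PUnit.unit := rfl
  rw [Finsupp.single_eq_same, MvPolynomial.mem_support_iff] at hs
  exact cycleRename_cycleRelation_bihomogeneous K m _ hs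

/-- The homogeneous syzygies of `x`-degree at least `2` of the linear relations. -/
abbrev CycleHigherSyzygy : Type u :=
  {p : (cycleGens K m →₀ MvPolynomial (Fin (m + 3) ⊕ cycleGens K m) K) × (ℕ × ℕ) //
    cycleRelationMap K m p.1 = 0 ∧ IsBihomogeneous (fun _ => (1, 1)) p.1 p.2 ∧ 2 ≤ p.2.1}

/-- The map from the free module on `cycleSyzygy` and the homogeneous syzygies of higher
`x`-degree. -/
noncomputable def cycleSyzygyMap (r : ℕ) :
    (Option (CycleHigherSyzygy K m) →₀ MvPolynomial (Fin (m + 3) ⊕ cycleGens K m) K)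
      →ₗ[MvPolynomial (Fin (m + 3) ⊕ cycleGens K m) K]
    (cycleGens K m →₀ MvPolynomial (Fin (m + 3) ⊕ cycleGens K m) K) :=
  Finsupp.linearCombination _ fun o => o.elim (cycleSyzygy K m r) fun p => p.1.1

theorem cycleSyzygyMap_single (r : ℕ) (o : Option (CycleHigherSyzygy K m))
    (p : MvPolynomial (Fin (m + 3) ⊕ cycleGens K m) K) :
    cycleSyzygyMap K m r (Finsupp.single o p) =
      p • o.elim (cycleSyzygy K m r) fun p => p.1.1 :=
  Finsupp.linearCombination_single _ _ _

/-- The first syzygies of the linear relations: the syzygy `cycleSyzygy`, and all homogeneous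
syzygies of `x`-degree at least `2`. -/
noncomputable def cycleSyzygies (r : ℕ) :
    BigradedFreeMap K (Fin (m + 3)) (cycleGens K m) where
  ι₀ := cycleGens K m
  ι₁ := Option (CycleHigherSyzygy K m)
  deg₀ := fun _ => (1, 1)
  deg₁ := fun o => o.elim (1, r + 1) fun p => p.1.2
  d := cycleSyzygyMap K m r
  homogeneous := by
    rintro (_ | p)
    · rw [cycleSyzygyMap_single, one_smul]
      intro c s hs
      have := cycleRename_alternatingY_bihomogeneous K m r _ (MvPolynomial.mem_support_iff.1 hs)
      rw [bidegree_eq_weight, this]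
      simp
    · rw [cycleSyzygyMap_single, one_smul]
      exact p.2.2.1

/-- Bihomogeneous syzygies suffice. Those of `x`-degree at least 2 are basis elements by
construction. In smaller `x`-degree the coefficients are free of `x`, so they equal their values at
`x = 0` and form a multiple of `(q_j)`. -/
theorem exact_cycleSyzygies {r : ℕ} (hm : m + 2 = 2 * r) :
    Function.Exact (cycleSyzygyMap K m r) (cycleRelationMap K m) := by
  rw [LinearMap.exact_iff]
  apply le_antisymm
  · refine ker_le_of_bihomogeneous (cycleRelationMap K m) (cycleRelationMap_bihomogeneous K m) _
      fun v e hv he => ?_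
    by_cases he2 : 2 ≤ e.1
    · exact ⟨Finsupp.single (some ⟨(v, e), hv, he, he2⟩) 1, by simp [cycleSyzygyMap_single]⟩
    have hfst : ∀ g, ∀ s ∈ (v g).support, (bidegree s).1 = 0 := by
      intro g s hs
      have := congrArg Prod.fst (he g s hs)
      simp only [Prod.fst_add] at this
      omega
    rw [cycleRelationMap_apply, Finsupp.single_eq_zero] at hv
    have hsyz : ∑ j, (cycleRename K m).symm (v (cycleGensEquiv K m j)) * cycleRelation K j = 0 := by
      apply (cycleRename K m).injective
      simpa only [map_sum, map_mul, AlgEquiv.apply_symm_apply, map_zero] using hv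
    obtain ⟨c, hc⟩ := exists_evalXZero_eq_of_syzygy hm _ hsyz
    refine ⟨Finsupp.single none (cycleRename K m (MvPolynomial.rename Sum.inr c)), ?_⟩
    rw [cycleSyzygyMap_single]
    ext1 g
    obtain ⟨j, rfl⟩ := (cycleGensEquiv K m).surjective g
    rw [Finsupp.smul_apply, Option.elim_none, cycleSyzygy_apply, Equiv.symm_apply_apply, smul_eq_mul,
      ← map_mul, alternatingY, ← map_mul, ← hc, cycleRename_evalXZero,
      aeval_eq_self_of_bidegree_fst_eq_zero _ (hfst _)]
  · rw [LinearMap.range_le_ker_iff]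
    refine Finsupp.lhom_ext' fun b => LinearMap.ext_ring ?_
    simp only [LinearMap.comp_apply, Finsupp.lsingle_apply, cycleSyzygyMap_single, one_smul,
      LinearMap.zero_apply]
    rcases b with _ | p
    · exact cycleRelationMap_cycleSyzygy K m hm
    · exact p.2.1

/-- The augmentation `S → 𝓡(I)`. -/
noncomputable def cycleAug :
    (PUnit.{u + 1} →₀ MvPolynomial (Fin (m + 3) ⊕ cycleGens K m) K)
      →ₗ[MvPolynomial (Fin (m + 3) ⊕ cycleGens K m) K] ReesOfGenerators (cycleGens K m) :=
  Finsupp.linearCombination _ fun _ => (1 : ReesOfGenerators (cycleGens K m))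

theorem cycleAug_single (p : MvPolynomial (Fin (m + 3) ⊕ cycleGens K m) K) :
    cycleAug K m (Finsupp.single PUnit.unit p) = reesPresentation (cycleGens K m) p := by
  rw [cycleAug, Finsupp.linearCombination_single]
  change reesPresentation (cycleGens K m) p * 1 = _
  rw [mul_one]

theorem cycleAug_surjective : Function.Surjective (cycleAug K m) := by
  intro x
  obtain ⟨s, hs⟩ := lift_toReesDegreeOne_surjective (edgeComplIdeal K (m + 2)) x
  obtain ⟨p, rfl⟩ := cycleSym_surjective K (m + 2) s
  refine ⟨Finsupp.single PUnit.unit (cycleRename K m p), ?_⟩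
  rw [cycleAug_single]
  have h1 := reesPresentation_cycleRename K m p
  rw [← coe_lift_cycleSym, hs] at h1
  exact Subtype.ext h1

theorem exact_cycleAug {r : ℕ} (hm : m + 2 = 2 * r) :
    Function.Exact (cycleRelationMap K m) (cycleAug K m) := by
  intro v
  obtain ⟨p, rfl⟩ : ∃ p, v = Finsupp.single PUnit.unit (cycleRename K m p) :=
    ⟨(cycleRename K m).symm (v PUnit.unit), Finsupp.ext fun c => by cases c; simp⟩
  have hker : cycleAug K m (Finsupp.single PUnit.unit (cycleRename K m p)) = 0 ↔
      p ∈ cycleRelationIdeal K (m + 2) := by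
    rw [cycleAug_single, ← ker_cycleRees hm (by omega), RingHom.mem_ker,
      ← reesPresentation_cycleRename]
    exact (map_eq_zero_iff (reesAlgebra (Ideal.span (cycleGens K m))).val
      Subtype.val_injective).symm
  rw [hker, cycleRelationIdeal, Ideal.mem_span_range_iff_exists_fun]
  constructor
  · rintro ⟨c, rfl⟩
    refine ⟨Finsupp.equivFunOnFinite.symm fun g =>
      cycleRename K m (c ((cycleGensEquiv K m).symm g)), ?_⟩
    rw [cycleRelationMap_apply]
    simp
  · rintro ⟨w, hw⟩
    refine ⟨fun j => (cycleRename K m).symm (w (cycleGensEquiv K m j)), ?_⟩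
    apply (cycleRename K m).injective
    rw [cycleRelationMap_apply] at hw
    simpa using Finsupp.single_injective _ hw

/-- The resolution need not be minimal: the basis element mapping to `(q_j)` has `x`-degree 1 while
all others in homological degree 2 have `x`-degree at least 2, which is enough for the `Tor`
criterion. The bound is `(r + 1) - 2`. -/
theorem le_reesYRegularity_cycleGens {r : ℕ} (hm : m + 2 = 2 * r) (δ : ℕ) :
    (r : EReal) - 1 ≤ reesYRegularity (cycleGens K m) δ := by
  let F : BigradedFreeResolution K (Fin (m + 3)) (cycleGens K m)
      (reesPiece (cycleGens K m) δ) :=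
    BigradedFreeResolution.ofSyzygies (cycleSyzygies K m r) PUnit (fun _ => (0, 0))
      (cycleRelationMap K m) (cycleAug K m) (cycleRelationMap_bihomogeneous K m)
      (fun b => by
        rw [cycleAug_single, map_one]
        refine ⟨1, ?_, ?_⟩
        · exact MvPolynomial.isHomogeneous_one _ _
        · exact Polynomial.monomial_zero_one)
      (cycleAug_surjective K m) (exact_cycleAug K m hm) (exact_cycleSyzygies K m hm)
  have hd : cycleSyzygyMap K m r (Finsupp.single none 1) = cycleSyzygy K m r :=
    (cycleSyzygyMap_single K m r _ _).trans (one_smul _ _)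
  have hconst : ∀ g, MvPolynomial.constantCoeff (cycleSyzygy K m r g) = 0 := by
    intro g
    by_contra h
    have := cycleRename_alternatingY_bihomogeneous K m r ((cycleGensEquiv K m).symm g) h
    rw [map_zero, Prod.ext_iff] at this
    have := this.2
    simp only [Prod.snd_zero] at this
    omega
  have hne : cycleSyzygy K m r ≠ 0 := by
    intro h
    have h1 := DFunLike.congr_fun h (cycleGensEquiv K m 0)
    rw [cycleSyzygy_apply, Finsupp.zero_apply, map_eq_zero_iff _ (cycleRename K m).injective,
      alternatingY, map_eq_zero_iff _ (MvPolynomial.rename_injective _ Sum.inr_injective)] at h1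
    exact alternatingMonomial_ne_zero _ _ h1
  have htor : TorNeZero K (Fin (m + 3)) (cycleGens K m) (reesPiece (cycleGens K m) δ) 2
      (1, r + 1) := by
    refine F.torNeZero 1 (none : (cycleSyzygies K m r).ι₁) ?_ ?_ ?_
    · exact fun c => (congrArg (fun v => MvPolynomial.constantCoeff (v c)) hd).trans (hconst c)
    · exact fun h => hne (hd.symm.trans h)
    · rintro (_ | p) hp s hs
      · exact hp rfl
      · have h1 : bidegree s + p.1.2 = (1, r + 1) := hs
        have h2 := congrArg Prod.fst h1
        have h3 := p.2.2.2
        simp only [Prod.fst_add] at h2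
        omega
  have htop : ((r + 1 : ℕ) : EReal) ≤ torTopYDegree K (Fin (m + 3)) (cycleGens K m)
      (reesPiece (cycleGens K m) δ) 2 := le_sSup ⟨1, r + 1, htor, rfl⟩
  refine le_trans ?_ (le_iSup _ 2)
  refine le_trans (le_of_eq ?_) (EReal.sub_le_sub htop le_rfl)
  have e : ((r : ℝ) - 1 : ℝ) = ((r + 1 : ℕ) : ℝ) - ((2 : ℕ) : ℝ) := by push_cast; ring
  have := congrArg (fun x : ℝ => (x : EReal)) e
  simpa only [EReal.coe_sub, EReal.coe_natCast, EReal.coe_one] using this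

end YRegularity

theorem mainTheorem2 (K : Type u) [Field K] (r n : ℕ) (hr : 2 ≤ r) (hn : n = 2 * r + 1) :
    (r : EReal) - 1 ≤
        reesYRegularity (pathMonomials K (SimpleGraph.cycleGraph n) (n - 2)) (n - 2) ∧
      IsOfLinearType (pathIdeal K (SimpleGraph.cycleGraph n) (n - 2)) ∧
      ¬ ∃ (m : ℕ) (a : Fin m → MvPolynomial (Fin n) K), IsDSequence a ∧
        Ideal.span (Set.range a) = pathIdeal K (SimpleGraph.cycleGraph n) (n - 2) := by
  obtain ⟨m, rfl⟩ : ∃ m, n = m + 3 := ⟨n - 3, by omega⟩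
  have hm : m + 2 = 2 * r := by omega
  have hgens : pathMonomials K (SimpleGraph.cycleGraph (m + 3)) (m + 3 - 2) = cycleGens K m :=
    pathMonomials_cycleGraph K m
  have hideal : pathIdeal K (SimpleGraph.cycleGraph (m + 3)) (m + 3 - 2) =
      edgeComplIdeal K (m + 2) := by
    rw [pathIdeal, hgens]
    rfl
  rw [hideal, hgens]
  refine ⟨le_reesYRegularity_cycleGens K m hm _, isOfLinearType_edgeComplIdeal K _ hm (by omega), ?_⟩
  rintro ⟨M, a, ha, hspan⟩
  exact not_exists_dSequence hm hr a ha hspan
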